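/- Call a closed set $K\subset\mathbb{R}^2$ a closed polygonal disk if it is bounded, its boundary is a finite union of straight segments, and it is homeomorphic to the closed unit disk. Let $\Omega_{\rm p}\subset\mathbb{R}^2$ be a regular bounded polytope, that is, $$\Omega_{\rm p} = \mathring{K}_{\rm ext}\setminus \bigcup_{i=1}^N K_{i},$$ where $N\ge 0$, $K_{\rm ext},K_1,\dots,K_N$ are closed polygonal disks, $\mathring{K}_{\rm ext}$ is the interior of $K_{\rm ext}$, and $K_1,\dots,K_N$ are pairwise disjoint and contained in $\mathring{K}_{\rm ext}$. Let $\mathbf{n}$ denote the outward unit normal to $\Omega_{\rm p}$, defined at all points of $\partial\Omega_{\rm p}$ except the vertices. Let $\varphi\in C^1(\overline{\Omega}_{\rm p};\mathbb{R}^2)$, that is, $\varphi$ is continuous on $\overline{\Omega}_{\rm p}$, continuously differentiable in the open set $\Omega_{\rm p}$, and $\nabla\varphi$ extends continuously to $\overline{\Omega}_{\rm p}$; and suppose that $\varphi\cdot\mathbf{n}=0$ on $\partial\Omega_{\rm p}$ wherever $\mathbf{n}$ is defined. Set $\Phi=\mathrm{id}+\varphi$. If the Jacobian determinant $J(\Phi)=\det\nabla\Phi$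 (extended by continuity to $\overline{\Omega}_{\rm p}$) satisfies $\min_{x\in\overline{\Omega}_{\rm p}}J(\Phi)(x)>0$, then $\Phi$ is a bijection of $\Omega_{\rm p}$ onto itself. -/

import Mathlib

open Set Filter Topology

noncomputable section

/-- The Euclidean plane. -/
abbrev Plane : Type := EuclideanSpace ℝ (Fin 2)

/-- A bounded polytope of the plane: a bounded set whose boundary consists of finitely many
straight segments. -/
def IsBoundedPolytope (P : Set Plane) : Prop :=
  Bornology.IsBounded P ∧
    ∃ S : Set (Plane × Plane), S.Finite ∧ frontier P = ⋃ p ∈ S, segment ℝ p.1 p.2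

/-- A closed polygonal disk: a bounded polytope that is homeomorphic to the closed unit ball. -/
def IsPolygonalDisk (K : Set Plane) : Prop :=
  IsBoundedPolytope K ∧ Nonempty (K ≃ₜ Metric.closedBall (0 : Plane) 1)

/-- A regular bounded polytope, as an open set: the open region enclosed by an outer polygonal disk,
from which finitely many (possibly no) pairwise disjoint closed polygonal disks, each of them
contained in that open region (hence compactly embedded in it), are removed. -/
def IsRegularPolytope (Ω : Set Plane) : Prop :=
  ∃ (N : ℕ) (Kext : Set Plane) (Kint : Fin N → Set Plane),
    IsPolygonalDisk Kext ∧
    (∀ i, IsPolygonalDisk (Kint i)) ∧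
    (∀ i, Kint i ⊆ interior Kext) ∧
    (Pairwise fun i j => Disjoint (Kint i) (Kint j)) ∧
    Ω = interior Kext \ ⋃ i, Kint i

/-- `n` is the outward unit normal to the open set `Ω` at `x`: near `x`, the set `Ω` coincides with
the open half-plane through `x` which has outward unit normal `n`. For a regular polytope this
singles out exactly one vector at each boundary point that is not a vertex, and none at a vertex. -/
def IsOutwardNormal (Ω : Set Plane) (x n : Plane) : Prop :=
  ‖n‖ = 1 ∧ ∃ ε > 0, ∀ y ∈ Metric.ball x ε, y ∈ Ω ↔ inner ℝ (y - x) n < 0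

/-- The space of vector fields of class `C¹` up to the boundary of the open set `Ω`: continuous on
the closure, continuously differentiable in `Ω`, and with a gradient that extends continuously to
the closure. -/
def C1Closure (Ω : Set Plane) : Set (Plane → Plane) :=
  {φ | ContinuousOn φ (closure Ω) ∧ ContDiffOn ℝ 1 φ Ω ∧
    ∀ x ∈ closure Ω, ∃ L : Plane →L[ℝ] Plane, Tendsto (fderiv ℝ φ) (𝓝[Ω] x) (𝓝 L)}

/-- The fields of class `C¹` up to the boundary whose normal component vanishes on the boundary. -/
def tangentialC1 (Ω : Set Plane) : Set (Plane → Plane) :=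
  {φ | φ ∈ C1Closure Ω ∧
    ∀ x ∈ frontier Ω, ∀ n : Plane, IsOutwardNormal Ω x n → inner ℝ (φ x) n = 0}

/-- The Jacobian determinant of a map on the closure of `Ω`: the determinant of the gradient,
extended by continuity from `Ω` to the closure. -/
def jacobianDet (Ω : Set Plane) (Φ : Plane → Plane) (x : Plane) : ℝ :=
  (extendFrom Ω (fderiv ℝ Φ) x).det

end

/-!
A tangential `C¹` field vanishes at the corners of `Ω`, being orthogonal there to the normals of two
non-parallel edges; hence `Φ` fixes the corners and slides every edge along its own line.
The restriction of `Φ` to such a line, extended by the identity off the edges, is a function of one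
real variable whose derivative does not vanish on the edges. Such a function is increasing and maps
each edge onto itself, so `Φ` is a bijection of the boundary. As its tangential derivative is
positive and the Jacobian is positive, so is its normal derivative: near the boundary, `Φ` maps the
inner side of each edge to the inner side.

Now count the preimages in `Ω` of a point `y`. Off the corners, `Φ` coincides near each point of
`closure Ω` with a homeomorphism of the plane, and the count is locally constant, except that it
jumps by one when `y` crosses an edge into `Ω`. The complement of the finite set of corners is
connected and the count is zero far away, so each point of `Ω` has exactly one preimage and no point
off `closure Ω` has any.
-/

open scoped NNReal InnerProductSpace

section TwoDimensional

variable {E : Type*} [NormedAddCommGroup E] [InnerProductSpace ℝ E]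

theorem det_eq_mul_of_inner_eq_zero (b : OrthonormalBasis (Fin 2) ℝ E) {L : E →L[ℝ] E}
    (h : ⟪L (b 0), b 1⟫_ℝ = 0) : L.det = ⟪L (b 0), b 0⟫_ℝ * ⟪L (b 1), b 1⟫_ℝ := by
  rw [real_inner_comm] at h
  rw [ContinuousLinearMap.det, ← LinearMap.det_toMatrix b.toBasis, Matrix.det_fin_two]
  simp [LinearMap.toMatrix_apply, b.repr_apply_apply, real_inner_comm, h]

variable [hE : Fact (Module.finrank ℝ E = 2)]

theorem exists_orthonormalBasis_apply_one_eq {n : E} (hn : ‖n‖ = 1) :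
    ∃ b : OrthonormalBasis (Fin 2) ℝ E, b 1 = n := by
  have : FiniteDimensional ℝ E := .of_fact_finrank_eq_two
  have hv : Orthonormal ℝ (({1} : Set (Fin 2)).domRestrict fun _ => n) :=
    ⟨fun _ => hn, fun i j hij => absurd (Subsingleton.elim i j) hij⟩
  obtain ⟨b, hb⟩ := hv.exists_orthonormalBasis_extension_of_card_eq (by simp [hE.out])
  exact ⟨b, hb 1 rfl⟩

theorem exists_norm_eq_one_inner_eq_zero {w : E} (hw : w ≠ 0) :
    ∃ n : E, ‖n‖ = 1 ∧ ⟪w, n⟫_ℝ = 0 := by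
  obtain ⟨b, hb⟩ := exists_orthonormalBasis_apply_one_eq (norm_smul_inv_norm (𝕜 := ℝ) hw)
  have horth : ⟪b 1, b 0⟫_ℝ = 0 := b.orthonormal.2 one_ne_zero
  refine ⟨b 0, b.orthonormal.1 0, ?_⟩
  simpa [hb, inner_smul_left, hw] using horth

theorem inner_eq_zero_of_inner_eq_zero {w p z q : E} (hw : w ≠ 0) (hp : p ≠ 0)
    (hwp : ⟪w, p⟫_ℝ = 0) (hzp : ⟪z, p⟫_ℝ = 0) (hwq : ⟪w, q⟫_ℝ = 0) : ⟪z, q⟫_ℝ = 0 := by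
  have : Fact (Module.finrank ℝ E = 1 + 1) := hE
  have hdim : Module.finrank ℝ (ℝ ∙ p)ᗮ = 1 := Submodule.finrank_orthogonal_span_singleton hp
  have hmem {v : E} (hv : ⟪v, p⟫_ℝ = 0) : v ∈ (ℝ ∙ p)ᗮ :=
    Submodule.mem_orthogonal_singleton_iff_inner_left.2 hv
  obtain ⟨c, hc⟩ := exists_smul_eq_of_finrank_eq_one hdim
    (x := ⟨w, hmem hwp⟩) (by simpa using hw) ⟨z, hmem hzp⟩
  obtain rfl : c • w = z := congrArg Subtype.val hc
  rw [inner_smul_left, hwq, mul_zero]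

end TwoDimensional

theorem subset_or_subset_compl_of_disjoint_frontier {X : Type*} [TopologicalSpace X]
    {s A : Set X} (hs : IsPreconnected s) (h : Disjoint s (frontier A)) : s ⊆ A ∨ s ⊆ Aᶜ := by
  have hcover : s ⊆ interior A ∪ interior Aᶜ := by
    rwa [frontier_eq_inter_compl_interior, ← compl_union, disjoint_compl_right_iff_subset] at h
  have hdisj : Disjoint (interior A) (interior Aᶜ) :=
    disjoint_compl_right.mono interior_subset interior_subset
  exact (hs.subset_or_subset isOpen_interior isOpen_interior hdisj hcover).imp
    (·.trans interior_subset) (·.trans interior_subset)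

theorem frontier_iUnion_subset {X ι : Type*} [TopologicalSpace X] [Finite ι] (B : ι → Set X) :
    frontier (⋃ i, B i) ⊆ ⋃ i, frontier (B i) := by
  rintro x ⟨hcl, hint⟩
  obtain ⟨i, hi⟩ := mem_iUnion.1 (closure_iUnion_of_finite (f := B) ▸ hcl)
  exact mem_iUnion.2 ⟨i, hi, fun h => hint (interior_mono (subset_iUnion B i) h)⟩

theorem frontier_sdiff_subset {X : Type*} [TopologicalSpace X] (A B : Set X) :
    frontier (A \ B) ⊆ frontier A ∪ frontier B := by
  rw [sdiff_eq, ← frontier_compl B]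
  exact (frontier_inter_subset A Bᶜ).trans (union_subset_union inter_subset_left inter_subset_right)

theorem not_injOn_of_one_lt_rank {E : Type*} [NormedAddCommGroup E] [NormedSpace ℝ E]
    (hE : 1 < Module.rank ℝ E) {U : Set E} (hU : IsOpen U) (hne : U.Nonempty) {g : E → ℝ}
    (hg : ContinuousOn g U) : ¬ InjOn g U := by
  intro hinj
  obtain ⟨p, hp⟩ := hne
  obtain ⟨r, hr, hball⟩ := Metric.nhds_basis_closedBall.mem_iff.1 (hU.mem_nhds hp)
  have hadd {u : E} (hu : u ∈ Metric.sphere 0 r) : p + u ∈ U := hball (by simp_all)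
  have hsub {u : E} (hu : u ∈ Metric.sphere 0 r) : p - u ∈ U := hball (by simp_all)
  have hcont : ContinuousOn (fun u => g (p + u) - g (p - u)) (Metric.sphere 0 r) :=
    (hg.comp (by fun_prop) fun u => hadd).sub (hg.comp (by fun_prop) fun u => hsub)
  have : Nontrivial E := (rank_pos_iff_nontrivial (R := ℝ)).1 (zero_lt_one.trans hE)
  obtain ⟨v, hv⟩ : (Metric.sphere (0 : E) r).Nonempty := NormedSpace.sphere_nonempty.2 hr.le
  have hv' : -v ∈ Metric.sphere (0 : E) r := by simpa using hv
  obtain ⟨u, hu, hgu⟩ : ∃ u ∈ Metric.sphere 0 r, g (p + u) - g (p - u) = 0 := by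
    have hconn := isPreconnected_sphere hE 0 r
    rcases le_total (g (p + v)) (g (p - v)) with h | h
    · exact hconn.intermediate_value hv hv' hcont ⟨by linarith, by simpa [← sub_eq_add_neg] using h⟩
    · exact hconn.intermediate_value hv' hv hcont ⟨by simpa [← sub_eq_add_neg] using h, by linarith⟩
  have hneg : u = -u := by
    simpa [sub_eq_add_neg] using hinj (hadd hu) (hsub hu) (sub_eq_zero.1 hgu)
  have hzero : u = 0 := by simpa [← two_smul ℝ] using eq_neg_iff_add_eq_zero.1 hneg
  exact hr.ne (by simpa [hzero] using hu)

instance : Fact (Module.finrank ℝ Plane = 2) := ⟨finrank_euclideanSpace_fin⟩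

theorem Plane.one_lt_rank : 1 < Module.rank ℝ Plane :=
  Module.one_lt_rank_of_one_lt_finrank (by simp)

/-- The line `⟪y, n⟫ = c` of the plane, for `p = (n, c)`. -/
def Plane.line (p : Plane × ℝ) : Set Plane := {y | ⟪y, p.1⟫_ℝ = p.2}

theorem Plane.isClosed_line (p : Plane × ℝ) : IsClosed (Plane.line p) :=
  isClosed_eq (by fun_prop) continuous_const

theorem Plane.inner_sub_eq_zero {p : Plane × ℝ} {x y : Plane} (hx : x ∈ Plane.line p)
    (hy : y ∈ Plane.line p) : ⟪y - x, p.1⟫_ℝ = 0 := by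
  rw [inner_sub_left, sub_eq_zero]
  exact Eq.trans hy (Eq.symm hx)

theorem Plane.exists_segment_subset_line (a b : Plane) :
    ∃ p : Plane × ℝ, ‖p.1‖ = 1 ∧ segment ℝ a b ⊆ Plane.line p := by
  obtain ⟨n, hn, h⟩ : ∃ n : Plane, ‖n‖ = 1 ∧ ⟪b - a, n⟫_ℝ = 0 := by
    rcases eq_or_ne (b - a) 0 with hab | hab
    · obtain ⟨n, hn⟩ := exists_norm_eq Plane zero_le_one
      exact ⟨n, hn, by rw [hab, inner_zero_left]⟩
    · exact exists_norm_eq_one_inner_eq_zero hab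
  refine ⟨(n, ⟪a, n⟫_ℝ), hn, ?_⟩
  rw [segment_eq_image']
  rintro _ ⟨t, -, rfl⟩
  simp [Plane.line, inner_add_left, inner_smul_left, h]

/-- A set lies on finitely many lines of the plane, each of them given by a unit normal and its
offset. -/
def IsCoveredByFinitelyManyLines (s : Set Plane) : Prop :=
  ∃ T : Set (Plane × ℝ), T.Finite ∧ (∀ p ∈ T, ‖p.1‖ = 1) ∧ s ⊆ ⋃ p ∈ T, Plane.line p

theorem IsCoveredByFinitelyManyLines.mono {s t : Set Plane} (ht : IsCoveredByFinitelyManyLines t)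
    (hst : s ⊆ t) : IsCoveredByFinitelyManyLines s := by
  obtain ⟨T, hT, hunit, hcover⟩ := ht
  exact ⟨T, hT, hunit, hst.trans hcover⟩

theorem IsCoveredByFinitelyManyLines.biUnion {ι : Type*} {I : Set ι} (hI : I.Finite)
    {s : ι → Set Plane} (hs : ∀ i ∈ I, IsCoveredByFinitelyManyLines (s i)) :
    IsCoveredByFinitelyManyLines (⋃ i ∈ I, s i) := by
  choose! T hT hunit hcover using hs
  refine ⟨⋃ i ∈ I, T i, hI.biUnion hT, ?_, ?_⟩
  · simp only [mem_iUnion₂]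
    rintro p ⟨i, hi, hp⟩
    exact hunit i hi p hp
  · exact iUnion₂_subset fun i hi =>
      (hcover i hi).trans (biUnion_subset_biUnion_left (subset_biUnion_of_mem hi))

theorem IsCoveredByFinitelyManyLines.union {s t : Set Plane} (hs : IsCoveredByFinitelyManyLines s)
    (ht : IsCoveredByFinitelyManyLines t) : IsCoveredByFinitelyManyLines (s ∪ t) := by
  simpa [union_eq_iUnion] using
    biUnion (finite_univ (α := Bool)) (s := fun i => cond i s t) (by simp [hs, ht])

theorem not_isCoveredByFinitelyManyLines_image {U : Set Plane} (hU : IsOpen U) (hne : U.Nonempty)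
    {F : Plane → Plane} (hF : ContinuousOn F U) (hinj : InjOn F U) :
    ¬ IsCoveredByFinitelyManyLines (F '' U) := by
  rintro ⟨T, hT, hunit, hcover⟩
  have := hU.baireSpace
  have := hne.to_subtype
  have := hT.countable.to_subtype
  obtain ⟨⟨p, hp⟩, hint⟩ := nonempty_interior_of_iUnion_of_closed
    (f := fun p : T => {u : U | F u ∈ Plane.line p})
    (fun p => (Plane.isClosed_line p).preimage (continuousOn_iff_continuous_domRestrict.1 hF))
    (eq_univ_of_forall fun u => by simpa using hcover (mem_image_of_mem F u.2))
  set V : Set Plane := Subtype.val '' interior {u : U | F u ∈ Plane.line p}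
  have hVU : V ⊆ U := Subtype.coe_image_subset _ _
  have hV : IsOpen V := hU.isOpenMap_subtype_val _ isOpen_interior
  have hline : ∀ u ∈ V, F u ∈ Plane.line p := by
    rintro _ ⟨u, hu, rfl⟩
    exact interior_subset (X := U) hu
  obtain ⟨b, hb⟩ := exists_orthonormalBasis_apply_one_eq (hunit p hp)
  refine not_injOn_of_one_lt_rank Plane.one_lt_rank hV (hint.image _) (g := fun u => ⟪F u, b 0⟫_ℝ)
    ((hF.mono hVU).inner continuousOn_const) fun u hu v hv huv => hinj (hVU hu) (hVU hv) ?_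
  refine InnerProductSpace.ext_inner_right_basis b.toBasis fun i => ?_
  fin_cases i
  · simpa using huv
  · simpa [hb] using (hline u hu).trans (hline v hv).symm

theorem IsBoundedPolytope.isCoveredByFinitelyManyLines_frontier {P : Set Plane}
    (hP : IsBoundedPolytope P) : IsCoveredByFinitelyManyLines (frontier P) := by
  obtain ⟨-, S, hS, hfr⟩ := hP
  rw [hfr]
  refine .biUnion hS fun p _ => ?_
  obtain ⟨l, hl, hsub⟩ := Plane.exists_segment_subset_line p.1 p.2
  exact ⟨{l}, finite_singleton l, by simpa using hl, by simpa using hsub⟩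

theorem IsPolygonalDisk.isClosed {K : Set Plane} (hK : IsPolygonalDisk K) : IsClosed K := by
  obtain ⟨e⟩ := hK.2
  have : CompactSpace (Metric.closedBall (0 : Plane) 1) :=
    isCompact_iff_compactSpace.1 (isCompact_closedBall 0 1)
  have : CompactSpace K := e.symm.compactSpace
  exact (isCompact_iff_compactSpace.2 this).isClosed

theorem IsPolygonalDisk.subset_closure_interior {K : Set Plane} (hK : IsPolygonalDisk K) :
    K ⊆ closure (interior K) := by
  obtain ⟨e⟩ := hK.2
  obtain ⟨F, hF⟩ := ContinuousMap.exists_restrict_eq Metric.isClosed_closedBall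
    ⟨_, continuous_subtype_val.comp e.symm.continuous⟩
  have hFe (q : Metric.closedBall (0 : Plane) 1) : F q = e.symm q := DFunLike.congr_fun hF q
  intro x hx
  refine mem_closure_iff.2 fun W hW hxW => ?_
  by_contra hdisj
  have hcl : (e ⟨x, hx⟩ : Plane) ∈ closure (Metric.ball 0 1) := by
    rw [closure_ball _ one_ne_zero]
    exact (e ⟨x, hx⟩).2
  have hne : (F ⁻¹' W ∩ Metric.ball 0 1).Nonempty :=
    mem_closure_iff.1 hcl _ (hW.preimage F.continuous) (by simpa [hFe] using hxW)
  refine not_isCoveredByFinitelyManyLines_image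
    ((hW.preimage F.continuous).inter Metric.isOpen_ball) hne F.continuous.continuousOn ?_
    (hK.1.isCoveredByFinitelyManyLines_frontier.mono ?_)
  · rintro q ⟨-, hq⟩ q' ⟨-, hq'⟩ h
    lift q to Metric.closedBall (0 : Plane) 1 using Metric.ball_subset_closedBall hq
    lift q' to Metric.closedBall (0 : Plane) 1 using Metric.ball_subset_closedBall hq'
    rw [hFe, hFe] at h
    exact congrArg _ (e.symm.injective (Subtype.ext h))
  · rintro _ ⟨q, ⟨hqW, hq⟩, rfl⟩
    lift q to Metric.closedBall (0 : Plane) 1 using Metric.ball_subset_closedBall hq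
    refine ⟨subset_closure (hFe q ▸ (e.symm q).2), fun hint => hdisj ⟨F q, hqW, hint⟩⟩

/-- A polygon, possibly disconnected and with holes: a bounded open set whose frontier lies on
finitely many lines. The condition `interior (closure Ω) = Ω` excludes slits. -/
structure IsPolygonalRegion (Ω : Set Plane) : Prop where
  isBounded : Bornology.IsBounded Ω
  interior_closure : interior (closure Ω) = Ω
  isCoveredByFinitelyManyLines_frontier : IsCoveredByFinitelyManyLines (frontier Ω)

theorem IsRegularPolytope.isPolygonalRegion {Ω : Set Plane} (hΩ : IsRegularPolytope Ω) :
    IsPolygonalRegion Ω := by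
  obtain ⟨N, Kext, Kint, hext, hint, -, -, rfl⟩ := hΩ
  set Ω := interior Kext \ ⋃ i, Kint i
  have hopen : IsOpen Ω :=
    isOpen_interior.sdiff (isClosed_iUnion_of_finite fun i => (hint i).isClosed)
  have hsub : Ω ⊆ Kext := sdiff_subset.trans interior_subset
  refine ⟨hext.1.1.subset hsub, ?_, ?_⟩
  · refine Subset.antisymm (fun x hx => ?_) (interior_maximal subset_closure hopen)
    refine ⟨interior_mono (closure_minimal hsub hext.isClosed) hx, fun hxK => ?_⟩
    obtain ⟨i, hi⟩ := mem_iUnion.1 hxK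
    obtain ⟨y, hy, hyi⟩ :=
      mem_closure_iff.1 ((hint i).subset_closure_interior hi) _ isOpen_interior hx
    obtain ⟨z, hzi, hz⟩ := mem_closure_iff.1 (interior_subset hy) _ isOpen_interior hyi
    exact hz.2 (mem_iUnion.2 ⟨i, interior_subset hzi⟩)
  · have hunion : IsCoveredByFinitelyManyLines (⋃ i, frontier (Kint i)) := by
      simpa using IsCoveredByFinitelyManyLines.biUnion finite_univ fun i _ =>
        (hint i).1.isCoveredByFinitelyManyLines_frontier
    exact (hext.1.isCoveredByFinitelyManyLines_frontier.union hunion).mono <|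
      (frontier_sdiff_subset _ _).trans <|
        union_subset_union frontier_interior_subset (frontier_iUnion_subset _)

theorem convex_inner_sub_neg {E : Type*} [NormedAddCommGroup E] [InnerProductSpace ℝ E] (x n : E) :
    Convex ℝ {y | ⟪y - x, n⟫_ℝ < 0} := by
  simp_rw [inner_sub_left, sub_neg]
  exact convex_halfSpace_lt ((innerₗ E).flip n).isLinear _

theorem exists_mem_inner_lt {E : Type*} [NormedAddCommGroup E] [InnerProductSpace ℝ E] {O : Set E}
    (hO : IsOpen O) {z n : E} (hz : z ∈ O) (hn : n ≠ 0) : ∃ y ∈ O, ⟪y, n⟫_ℝ < ⟪z, n⟫_ℝ := by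
  have hlim : Tendsto (fun t : ℝ => z - t • n) (𝓝[>] 0) (𝓝 z) :=
    tendsto_nhdsWithin_of_tendsto_nhds (Continuous.tendsto' (by fun_prop) _ _ (by simp))
  obtain ⟨t, ht, ht0⟩ := ((hlim.eventually (hO.mem_nhds hz)).and self_mem_nhdsWithin).exists
  refine ⟨z - t • n, ht, ?_⟩
  rw [inner_sub_left, inner_smul_left]
  exact sub_lt_self _ (mul_pos ht0 (real_inner_self_pos.2 hn))

namespace IsOutwardNormal

variable {Ω : Set Plane} {x n : Plane}

theorem ne_zero (h : IsOutwardNormal Ω x n) : n ≠ 0 := norm_ne_zero_iff.1 (by simp [h.1])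

theorem eventually_mem_iff (h : IsOutwardNormal Ω x n) :
    ∀ᶠ y in 𝓝 x, (y ∈ Ω ↔ ⟪y - x, n⟫_ℝ < 0) := by
  obtain ⟨-, ε, hε, hball⟩ := h
  exact Metric.eventually_nhds_iff_ball.2 ⟨ε, hε, hball⟩

theorem notMem (h : IsOutwardNormal Ω x n) : x ∉ Ω := by
  rw [h.eventually_mem_iff.self_of_nhds]
  simp

theorem mem_closure (h : IsOutwardNormal Ω x n) : x ∈ closure Ω := by
  obtain ⟨W, hWiff, hW, hxW⟩ := eventually_nhds_iff.1 h.eventually_mem_iff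
  refine mem_closure_iff.2 fun O hO hxO => ?_
  obtain ⟨y, ⟨hyO, hyW⟩, hy⟩ := exists_mem_inner_lt (hO.inter hW) ⟨hxO, hxW⟩ h.ne_zero
  exact ⟨y, hyO, (hWiff y hyW).2 (by rwa [inner_sub_left, sub_neg])⟩

theorem mem_frontier (h : IsOutwardNormal Ω x n) : x ∈ frontier Ω :=
  ⟨h.mem_closure, fun hx => h.notMem (interior_subset hx)⟩

theorem eventually_of_inner_eq_zero (h : IsOutwardNormal Ω x n) :
    ∀ᶠ y in 𝓝 x, ⟪y - x, n⟫_ℝ = 0 → IsOutwardNormal Ω y n := by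
  filter_upwards [h.eventually_mem_iff.eventually_nhds] with y hy hy0
  obtain ⟨ε, hε, hball⟩ := Metric.eventually_nhds_iff_ball.1 hy
  refine ⟨h.1, ε, hε, fun z hz => ?_⟩
  rw [hball z hz, ← sub_add_sub_cancel z y x, inner_add_left, hy0, add_zero]

theorem eventually_of_mem_frontier (h : IsOutwardNormal Ω x n) :
    ∀ᶠ y in 𝓝 x, y ∈ frontier Ω → IsOutwardNormal Ω y n := by
  filter_upwards [h.eventually_of_inner_eq_zero, h.eventually_mem_iff.eventually_nhds]
    with y hy hev hfr
  have hcont : ContinuousAt (fun z : Plane => ⟪z - x, n⟫_ℝ) y := by fun_prop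
  refine hy ?_
  rcases lt_trichotomy ⟪y - x, n⟫_ℝ 0 with hlt | heq | hgt
  · have hint : y ∈ interior Ω := mem_interior_iff_mem_nhds.2 <| by
      filter_upwards [hev, hcont.eventually_lt_const hlt] with z hz using hz.2
    exact absurd hint hfr.2
  · exact heq
  · refine absurd (frontier_subset_closure hfr) fun hcl => mem_closure_iff_frequently.1 hcl ?_
    filter_upwards [hev, hcont.eventually_const_lt hgt] with z hz hz' hzΩ
    exact (hz.1 hzΩ).not_gt hz'

theorem unique {m : Plane} (h : IsOutwardNormal Ω x n) (h' : IsOutwardNormal Ω x m) : n = m := by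
  by_contra hne
  have hlt : ⟪n, m⟫_ℝ < 1 := (inner_lt_one_iff_real_of_norm_eq_one h.1 h'.1).2 hne
  have hlim : Tendsto (fun t : ℝ => x + t • (m - n)) (𝓝[>] 0) (𝓝 x) :=
    tendsto_nhdsWithin_of_tendsto_nhds (Continuous.tendsto' (by fun_prop) _ _ (by simp))
  obtain ⟨t, ⟨hn, hm⟩, ht : 0 < t⟩ := ((hlim.eventually (h.eventually_mem_iff.and
    h'.eventually_mem_iff)).and self_mem_nhdsWithin).exists
  have hside : ⟪t • (m - n), n⟫_ℝ < 0 ↔ ⟪t • (m - n), m⟫_ℝ < 0 := by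
    simpa only [add_sub_cancel_left] using hn.symm.trans hm
  simp only [inner_smul_left, inner_sub_left, real_inner_self_eq_norm_sq, h.1, h'.1,
    real_inner_comm n m, RCLike.conj_to_real, one_pow] at hside
  have hneg : t * (⟪n, m⟫_ℝ - 1) < 0 := mul_neg_of_pos_of_neg ht (sub_neg.2 hlt)
  have hpos : 0 < t * (1 - ⟪n, m⟫_ℝ) := mul_pos ht (sub_pos.2 hlt)
  exact (hside.1 hneg).not_gt hpos

theorem eventually_convex_inter_ball (h : IsOutwardNormal Ω x n) :
    ∀ᶠ r in 𝓝[>] 0, Convex ℝ (Ω ∩ Metric.ball x r) := by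
  obtain ⟨-, ε, hε, hball⟩ := h
  filter_upwards [Ioc_mem_nhdsGT hε] with r hr
  have heq : Ω ∩ Metric.ball x r = {y | ⟪y - x, n⟫_ℝ < 0} ∩ Metric.ball x r := by
    ext y
    exact and_congr_left fun hy => hball y (Metric.ball_subset_ball hr.2 hy)
  exact heq ▸ (convex_inner_sub_neg x n).inter (convex_ball x r)

end IsOutwardNormal

theorem forall_mem_of_inner_neg_or_forall_inner_pos {Ω : Set Plane} (hΩ : IsOpen Ω) {x n : Plane}
    (hn : n ≠ 0) {ε : ℝ} (h : ∀ y ∈ Metric.ball x ε, y ∈ frontier Ω → ⟪y - x, n⟫_ℝ = 0) :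
    (∀ y ∈ Metric.ball x ε, ⟪y - x, n⟫_ℝ < 0 → y ∈ Ω) ∨
      ∀ y ∈ Metric.ball x ε, y ∈ Ω → 0 < ⟪y - x, n⟫_ℝ := by
  have hconn : IsPreconnected (Metric.ball x ε ∩ {y | ⟪y - x, n⟫_ℝ < 0}) :=
    ((convex_ball x ε).inter (convex_inner_sub_neg x n)).isPreconnected
  have hdisj : Disjoint (Metric.ball x ε ∩ {y | ⟪y - x, n⟫_ℝ < 0}) (frontier Ω) :=
    disjoint_left.2 fun y hy hfr => hy.2.ne (h y hy.1 hfr)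
  refine (subset_or_subset_compl_of_disjoint_frontier hconn hdisj).imp
    (fun hsub y hy hneg => hsub ⟨hy, hneg⟩) fun hsub y hy hyΩ => ?_
  by_contra! hnonpos
  obtain ⟨z, ⟨hzball, hz⟩, hlt⟩ := exists_mem_inner_lt (Metric.isOpen_ball.inter hΩ) ⟨hy, hyΩ⟩ hn
  refine hsub ⟨hzball, ?_⟩ hz
  rw [inner_sub_left, sub_nonpos] at hnonpos
  simpa [inner_sub_left] using hlt.trans_le hnonpos

theorem isOutwardNormal_or_isOutwardNormal_neg {Ω : Set Plane} (hΩ : interior (closure Ω) = Ω)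
    {x n : Plane} (hx : x ∈ frontier Ω) (hn : ‖n‖ = 1)
    (h : ∀ᶠ y in 𝓝 x, y ∈ frontier Ω → ⟪y - x, n⟫_ℝ = 0) :
    IsOutwardNormal Ω x n ∨ IsOutwardNormal Ω x (-n) := by
  have hopen : IsOpen Ω := hΩ ▸ isOpen_interior
  have hn0 : n ≠ 0 := norm_ne_zero_iff.1 (by simp [hn])
  obtain ⟨ε, hε, hball⟩ := Metric.eventually_nhds_iff_ball.1 h
  have hside := forall_mem_of_inner_neg_or_forall_inner_pos hopen hn0 hball
  have hside' := forall_mem_of_inner_neg_or_forall_inner_pos hopen (neg_ne_zero.2 hn0)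
    fun y hy hfr => by rw [inner_neg_right, hball y hy hfr, neg_zero]
  simp only [inner_neg_right, neg_lt_zero, neg_pos] at hside'
  rcases hside with hneg | hpos' <;> rcases hside' with hpos | hneg'
  · have hdense : Metric.ball x ε ⊆ closure Ω := fun y hy => mem_closure_iff.2 fun O hO hyO => by
      obtain ⟨z, ⟨hzO, hz⟩, hlt⟩ := exists_mem_inner_lt (hO.inter Metric.isOpen_ball) ⟨hyO, hy⟩ hn0
      by_cases hy0 : 0 < ⟪y - x, n⟫_ℝ
      · exact ⟨y, hyO, hpos y hy hy0⟩
      · rw [inner_sub_left, sub_pos, not_lt] at hy0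
        exact ⟨z, hzO, hneg z hz (by rw [inner_sub_left, sub_neg]; exact hlt.trans_le hy0)⟩
    rw [hopen.frontier_eq, ← hΩ] at hx
    exact absurd (mem_interior.2 ⟨_, hdense, Metric.isOpen_ball, Metric.mem_ball_self hε⟩) hx.2
  · exact .inl ⟨hn, ε, hε, fun y hy => ⟨hneg' y hy, hneg y hy⟩⟩
  · exact .inr ⟨by rwa [norm_neg], ε, hε, fun y hy => by
      rw [inner_neg_right, neg_lt_zero]
      exact ⟨hpos' y hy, hpos y hy⟩⟩
  · obtain ⟨y, hy, hyΩ⟩ := mem_closure_iff.1 hx.1 _ Metric.isOpen_ball (Metric.mem_ball_self hε)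
    exact absurd (hpos' y hy hyΩ) (hneg' y hy hyΩ).not_gt

/-- The vertices of a polygonal region, encoded as the frontier points without outward normal. -/
def corners (Ω : Set Plane) : Set Plane :=
  {x ∈ frontier Ω | ∀ n, ¬ IsOutwardNormal Ω x n}

theorem exists_isOutwardNormal_of_mem_frontier_sdiff_corners {Ω : Set Plane} {x : Plane}
    (hx : x ∈ frontier Ω \ corners Ω) : ∃ n, IsOutwardNormal Ω x n := by
  by_contra! h
  exact hx.2 ⟨hx.1, h⟩

theorem Plane.subsingleton_line_inter {p q : Plane × ℝ} (hp : p.1 ≠ 0) (hq : q.1 ≠ 0)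
    (hpq : Plane.line p ≠ Plane.line q) : (Plane.line p ∩ Plane.line q).Subsingleton := by
  rintro x ⟨hxp, hxq⟩ z ⟨hzp, hzq⟩
  by_contra hxz
  have hsub {p q : Plane × ℝ} (hp : p.1 ≠ 0) (hxp : x ∈ Plane.line p) (hzp : z ∈ Plane.line p)
      (hxq : x ∈ Plane.line q) (hzq : z ∈ Plane.line q) : Plane.line p ⊆ Plane.line q := by
    intro y hy
    have hyq : ⟪y - x, q.1⟫_ℝ = 0 := inner_eq_zero_of_inner_eq_zero (sub_ne_zero.2 (Ne.symm hxz)) hp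
      (Plane.inner_sub_eq_zero hxp hzp) (Plane.inner_sub_eq_zero hxp hy)
      (Plane.inner_sub_eq_zero hxq hzq)
    rw [inner_sub_left, sub_eq_zero] at hyq
    exact hyq.trans hxq
  exact hpq (Subset.antisymm (hsub hp hxp hzp hxq hzq) (hsub hq hxq hzq hxp hzp))

namespace IsPolygonalRegion

variable {Ω : Set Plane}

theorem isOpen (hΩ : IsPolygonalRegion Ω) : IsOpen Ω := hΩ.interior_closure ▸ isOpen_interior

theorem exists_finite_lines (hΩ : IsPolygonalRegion Ω) :
    ∃ (T : Set (Plane × ℝ)) (V : Set Plane), T.Finite ∧ V.Finite ∧ (∀ p ∈ T, ‖p.1‖ = 1) ∧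
      frontier Ω ⊆ ⋃ p ∈ T, Plane.line p ∧
      ∀ p ∈ T, ∀ x ∈ (frontier Ω ∩ Plane.line p) \ V,
        IsOutwardNormal Ω x p.1 ∨ IsOutwardNormal Ω x (-p.1) := by
  obtain ⟨T, hT, hunit, hcover⟩ := hΩ.isCoveredByFinitelyManyLines_frontier
  have hne : ∀ p ∈ T, p.1 ≠ 0 := fun p hp => norm_ne_zero_iff.1 (by simp [hunit p hp])
  set V : Set Plane := ⋃ p ∈ T, ⋃ q ∈ {q ∈ T | Plane.line p ≠ Plane.line q},
    Plane.line p ∩ Plane.line q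
  have hV : V.Finite := hT.biUnion fun p hp => (hT.subset (sep_subset _ _)).biUnion fun q hq =>
    (Plane.subsingleton_line_inter (hne p hp) (hne q hq.1) hq.2).finite
  refine ⟨T, V, hT, hV, hunit, hcover, ?_⟩
  rintro p hp x ⟨⟨hx, hxp⟩, hxV⟩
  have hcoincide : ∀ q ∈ T, x ∈ Plane.line q → Plane.line p = Plane.line q := by
    intro q hq hxq
    by_contra hpq
    exact hxV (mem_biUnion hp (mem_biUnion ⟨hq, hpq⟩ ⟨hxp, hxq⟩))
  refine isOutwardNormal_or_isOutwardNormal_neg hΩ.interior_closure hx (hunit p hp) ?_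
  have hnear : ∀ᶠ y in 𝓝 x, ∀ q ∈ T, y ∈ Plane.line q → x ∈ Plane.line q :=
    hT.eventually_all.2 fun q _ => by
      by_cases hxq : x ∈ Plane.line q
      · simp [hxq]
      · filter_upwards [(Plane.isClosed_line q).isOpen_compl.mem_nhds hxq] with y hy hyq
          using absurd hyq hy
  filter_upwards [hnear] with y hy hyfr
  obtain ⟨q, hq, hyq⟩ := mem_iUnion₂.1 (hcover hyfr)
  exact Plane.inner_sub_eq_zero hxp (hcoincide q hq (hy q hq hyq) ▸ hyq)

theorem finite_corners (hΩ : IsPolygonalRegion Ω) : (corners Ω).Finite := by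
  obtain ⟨T, V, -, hV, -, hcover, hnormal⟩ := hΩ.exists_finite_lines
  refine hV.subset fun x hx => ?_
  by_contra hxV
  obtain ⟨p, hp, hxp⟩ := mem_iUnion₂.1 (hcover hx.1)
  exact (hnormal p hp x ⟨⟨hx.1, hxp⟩, hxV⟩).elim (hx.2 _) (hx.2 _)

theorem eq_zero_of_mem_corners (hΩ : IsPolygonalRegion Ω) {ψ : Plane → Plane} {v : Plane}
    (hψ : ContinuousWithinAt ψ (frontier Ω) v)
    (htan : ∀ x n, IsOutwardNormal Ω x n → ⟪ψ x, n⟫_ℝ = 0) (hv : v ∈ corners Ω) : ψ v = 0 := by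
  by_contra hne
  obtain ⟨T, V, hT, hV, hunit, hcover, hnormal⟩ := hΩ.exists_finite_lines
  obtain ⟨m, hm, hψm⟩ := exists_norm_eq_one_inner_eq_zero hne
  -- If `ψ v ≠ 0`, all edges accumulating at `v` are directed by `ψ v`, so `v` is not a corner.
  have hline : ∀ p ∈ T, ∀ᶠ y in 𝓝 v, y ∈ frontier Ω ∩ Plane.line p → ⟪y - v, m⟫_ℝ = 0 := by
    intro p hp
    by_cases hacc : ∃ᶠ y in 𝓝[≠] v, y ∈ frontier Ω ∩ Plane.line p
    · have hacc' : ∃ᶠ y in 𝓝 v, y ∈ (frontier Ω ∩ Plane.line p) \ V :=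
        (hacc.and_eventually (nhdsNE_le_cofinite v hV.compl_mem_cofinite)).filter_mono
          nhdsWithin_le_nhds
      have hvp : v ∈ Plane.line p := (Plane.isClosed_line p).mem_of_frequently_of_tendsto
        (hacc'.mono fun y hy => hy.1.2) tendsto_id
      have hψy : ∀ y ∈ (frontier Ω ∩ Plane.line p) \ V, ⟪ψ y, p.1⟫_ℝ = 0 := fun y hy =>
        (hnormal p hp y hy).elim (htan y _) fun h => by simpa using htan y _ h
      have hψp : ⟪ψ v, p.1⟫_ℝ = 0 := isClosed_singleton.mem_of_frequently_of_tendsto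
        (frequently_nhdsWithin_iff.2 (hacc'.mono fun y hy => ⟨hψy y hy, hy.1.1⟩))
        (hψ.inner continuousWithinAt_const)
      exact .of_forall fun y hy => inner_eq_zero_of_inner_eq_zero hne
        (norm_ne_zero_iff.1 (by simp [hunit p hp])) hψp (Plane.inner_sub_eq_zero hvp hy.2) hψm
    · rw [not_frequently, eventually_nhdsWithin_iff] at hacc
      filter_upwards [hacc] with y hy hyp
      obtain rfl : y = v := by_contra fun hyv => hy hyv hyp
      simp
  have hflat : ∀ᶠ y in 𝓝 v, y ∈ frontier Ω → ⟪y - v, m⟫_ℝ = 0 := by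
    filter_upwards [hT.eventually_all.2 hline] with y hy hyfr
    obtain ⟨p, hp, hyp⟩ := mem_iUnion₂.1 (hcover hyfr)
    exact hy p hp ⟨hyfr, hyp⟩
  exact (isOutwardNormal_or_isOutwardNormal_neg hΩ.interior_closure hv.1 hm hflat).elim
    (hv.2 _) (hv.2 _)

end IsPolygonalRegion

section OneDimensional

variable {f : ℝ → ℝ} {G : Set ℝ}

theorem le_of_deriv_ne_zero_of_eqOn_id (hf : Continuous f) (hG : BddBelow G) (hid : EqOn f id Gᶜ)
    (hderiv : ∀ s ∈ G, deriv f s ≠ 0) {q : ℝ} (hq : q ∉ G) {s : ℝ} (hs : s ≤ q) : f s ≤ q := by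
  obtain ⟨a, ha⟩ := hG
  obtain ⟨b, hb⟩ := exists_lt (min a s)
  have hbG : b ∉ G := fun h => (ha h).not_gt (hb.trans_le (min_le_left _ _))
  have hbs : b ≤ s := (hb.trans_le (min_le_right _ _)).le
  obtain ⟨m, hm, hmax⟩ :=
    isCompact_Icc.exists_isMaxOn ⟨s, hbs, hs⟩ (hf.continuousOn (s := Icc b q))
  have hmG : m ∉ G := by
    intro hmem
    have hbm : b ≠ m := fun h => hbG (h ▸ hmem)
    have hmq : m ≠ q := fun h => hq (h ▸ hmem)
    have hloc := hmax.isLocalMax (Icc_mem_nhds (hm.1.lt_of_ne hbm) (hm.2.lt_of_ne hmq))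
    exact hderiv m hmem hloc.deriv_eq_zero
  calc f s ≤ f m := hmax ⟨hbs, hs⟩
    _ = m := hid hmG
    _ ≤ q := hm.2

theorem le_apply_of_deriv_ne_zero_of_eqOn_id (hf : Continuous f) (hG : BddAbove G)
    (hid : EqOn f id Gᶜ) (hderiv : ∀ s ∈ G, deriv f s ≠ 0) {q : ℝ} (hq : q ∉ G) {s : ℝ}
    (hs : q ≤ s) : q ≤ f s := by
  have h := le_of_deriv_ne_zero_of_eqOn_id (f := fun t => -f (-t)) (G := -G) (by fun_prop) hG.neg
    (fun t ht => by simpa using congrArg Neg.neg (hid (x := -t) ht))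
    (fun t ht => by simpa [deriv_comp_neg] using hderiv (-t) ht)
    (q := -q) (by simpa using hq) (neg_le_neg hs)
  simpa using h

theorem strictMono_of_deriv_ne_zero_of_eqOn_id (hf : Continuous f) (hG : Bornology.IsBounded G)
    (hid : EqOn f id Gᶜ) (hderiv : ∀ s ∈ G, deriv f s ≠ 0) : StrictMono f := by
  obtain ⟨hbelow, habove⟩ := isBounded_iff_bddBelow_bddAbove.1 hG
  have hinj : Function.Injective f := by
    refine Function.Injective.of_lt_imp_ne fun x y hxy heq => ?_
    -- The Rolle point `c` is a fixed point, so `f x = f y` lies on both sides of it.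
    obtain ⟨c, ⟨hxc, hcy⟩, hc⟩ := exists_deriv_eq_zero hxy hf.continuousOn heq
    have hcG : c ∉ G := fun h => hderiv c h hc
    have hle : ∀ s ≤ c, f s ≤ c := fun s =>
      le_of_deriv_ne_zero_of_eqOn_id hf hbelow hid hderiv hcG
    have hxc' : f x = c := le_antisymm (hle x hxc.le) <| heq ▸
      le_apply_of_deriv_ne_zero_of_eqOn_id hf habove hid hderiv hcG hcy.le
    have hmax : IsLocalMax f x := by
      filter_upwards [Iic_mem_nhds hxc] with s hs
      exact hxc' ▸ hle s hs
    have hxG : x ∈ G := by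
      by_contra h
      exact hxc.ne ((hid h).symm.trans hxc')
    exact hderiv x hxG hmax.deriv_eq_zero
  refine (hf.strictMono_of_inj hinj).resolve_right fun hanti => ?_
  obtain ⟨a, ha⟩ := hbelow
  obtain ⟨b, hb⟩ := exists_lt a
  obtain ⟨c, hc⟩ := exists_lt b
  have hfix : ∀ t < a, f t = t := fun t ht => hid fun h => (ha h).not_gt ht
  have := hanti hc
  rw [hfix b hb, hfix c (hc.trans hb)] at this
  exact this.not_gt hc

theorem bijOn_of_deriv_ne_zero_of_eqOn_id (hf : Continuous f) (hG : Bornology.IsBounded G)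
    (hid : EqOn f id Gᶜ) (hderiv : ∀ s ∈ G, deriv f s ≠ 0) : BijOn f G G := by
  have hmono := strictMono_of_deriv_ne_zero_of_eqOn_id hf hG hid hderiv
  obtain ⟨hbelow, habove⟩ := isBounded_iff_bddBelow_bddAbove.1 hG
  have htop : Tendsto f atTop atTop := by
    obtain ⟨a, ha⟩ := habove
    refine tendsto_id.congr' ?_
    filter_upwards [eventually_gt_atTop a] with t ht
    exact (hid fun h => (ha h).not_gt ht).symm
  have hbot : Tendsto f atBot atBot := by
    obtain ⟨a, ha⟩ := hbelow
    refine tendsto_id.congr' ?_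
    filter_upwards [eventually_lt_atBot a] with t ht
    exact (hid fun h => (ha h).not_gt ht).symm
  have hfix : ∀ s ∉ G, f s = s := fun s hs => hid hs
  refine ⟨fun s hs => ?_, hmono.injective.injOn, fun t ht => ?_⟩
  · by_contra h
    exact h ((hmono.injective (hfix _ h)).symm ▸ hs)
  · obtain ⟨s, rfl⟩ := hf.surjective htop hbot t
    refine ⟨s, ?_, rfl⟩
    by_contra h
    exact h (hfix s h ▸ ht)

end OneDimensional

section BoundaryRegularity

variable {E F : Type*} [NormedAddCommGroup E] [NormedSpace ℝ E] [NormedAddCommGroup F]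
  [NormedSpace ℝ F] {f : E → F} {s : Set E} {x : E} {L : E →L[ℝ] F}

theorem exists_mem_nhdsWithin_closure_approximatesLinearOn (hs : IsOpen s)
    (hd : DifferentiableOn ℝ f s) (hc : ContinuousOn f (closure s))
    (hL : Tendsto (fderiv ℝ f) (𝓝[s] x) (𝓝 L))
    (hconv : ∀ᶠ r in 𝓝[>] 0, Convex ℝ (s ∩ Metric.ball x r)) {c : ℝ≥0} (hc0 : 0 < c) :
    ∃ U ∈ 𝓝[closure s] x, ApproximatesLinearOn f L U c := by
  have hclose : ∀ᶠ y in 𝓝[s] x, ‖fderiv ℝ f y - L‖ < c :=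
    (tendsto_iff_norm_sub_tendsto_zero.1 hL).eventually_lt_const hc0
  obtain ⟨ε, hε, hball⟩ := Metric.eventually_nhds_iff_ball.1 (eventually_nhdsWithin_iff.1 hclose)
  obtain ⟨r, hr, ⟨hr0, hrε⟩⟩ := (hconv.and (Ioc_mem_nhdsGT hε)).exists
  have hlip : LipschitzOnWith c (f - ⇑L) (s ∩ Metric.ball x r) :=
    ApproximatesLinearOn.lipschitzOnWith fun y hy z hz =>
      hr.norm_image_sub_le_of_norm_fderiv_le' (𝕜 := ℝ)
        (fun w hw => (hd w hw.1).differentiableAt (hs.mem_nhds hw.1))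
        (fun w hw => (hball w (Metric.ball_subset_ball hrε hw.2) hw.1).le) hz hy
  have hcont : ContinuousOn (f - ⇑L) (closure (s ∩ Metric.ball x r)) :=
    (hc.mono (closure_mono inter_subset_left)).sub L.continuous.continuousOn
  refine ⟨closure s ∩ Metric.ball x r, inter_mem_nhdsWithin _ (Metric.ball_mem_nhds x hr0),
    ((hlip.closure hcont).mono ?_).approximatesLinearOn⟩
  rw [inter_comm, inter_comm s]
  exact Metric.isOpen_ball.inter_closure

theorem hasFDerivWithinAt_of_approximatesLinearOn {t : Set E} (hx : x ∈ t)
    (h : ∀ c : ℝ≥0, 0 < c → ∃ U ∈ 𝓝[t] x, ApproximatesLinearOn f L U c) :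
    HasFDerivWithinAt f L t x := by
  rw [hasFDerivWithinAt_iff_isLittleO, Asymptotics.isLittleO_iff]
  intro c hc
  obtain ⟨U, hU, happ⟩ := h ⟨c, hc.le⟩ hc
  filter_upwards [hU] with y hy
  exact happ y hy x (mem_of_mem_nhdsWithin hx hU)

theorem exists_homeomorph_eventuallyEq_of_approximatesLinearOn [FiniteDimensional ℝ E] {f : E → E}
    {t : Set E} {L : E →L[ℝ] E} (hdet : L.det ≠ 0)
    (h : ∀ c : ℝ≥0, 0 < c → ∃ U ∈ 𝓝[t] x, ApproximatesLinearOn f L U c) :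
    ∃ u : E ≃ₜ E, f =ᶠ[𝓝[t] x] u := by
  rcases subsingleton_or_nontrivial E with hE | hE
  · exact ⟨.refl E, .of_forall fun y => Subsingleton.elim _ _⟩
  set e := L.toContinuousLinearEquivOfDetNeZero hdet
  have heL : (e : E →L[ℝ] E) = L := L.coe_toContinuousLinearEquivOfDetNeZero hdet
  have hpos : 0 < ‖(e.symm : E →L[ℝ] E)‖₊⁻¹ := inv_pos.2 e.symm.norm_pos
  have hlim : Tendsto (fun c : ℝ≥0 => lipschitzExtensionConstant E * c) (𝓝[>] 0) (𝓝 0) :=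
    tendsto_nhdsWithin_of_tendsto_nhds (Continuous.tendsto' (by fun_prop) _ _ (by simp))
  obtain ⟨c, hc, hc0⟩ := ((hlim.eventually_lt_const hpos).and self_mem_nhdsWithin).exists
  obtain ⟨U, hU, happ⟩ := h c hc0
  rw [← heL] at happ
  obtain ⟨u, hu⟩ := happ.exists_homeomorph_extension (Or.inr hc)
  exact ⟨u, eventually_of_mem hU hu⟩

end BoundaryRegularity

section Fibers

variable {X Y : Type*} [TopologicalSpace X] [TopologicalSpace Y]

theorem eventually_homeomorph_apply_mem_iff (u : X ≃ₜ Y) {A : Set X} {B : Set Y} {x : X}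
    (hx : x ∈ closure A) (hmaps : ∀ᶠ z in 𝓝 x, z ∈ A → u z ∈ B)
    (hfrontier : ∀ᶠ z in 𝓝 x, z ∈ frontier A → u z ∉ B)
    (hconn : ∀ W ∈ 𝓝 (u x), ∃ V ∈ 𝓝 (u x), V ⊆ W ∧ IsPreconnected (B ∩ V)) :
    ∀ᶠ z in 𝓝 x, u z ∈ B ↔ z ∈ A := by
  obtain ⟨V, hV, hVsub, hVconn⟩ := hconn {y | (u.symm y ∈ A → y ∈ B) ∧
    (u.symm y ∈ frontier A → y ∉ B)} <| by
      rw [← u.map_nhds_eq, mem_map]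
      filter_upwards [hmaps, hfrontier] with z hz hz'
      simpa using ⟨hz, hz'⟩
  have hnear : u ⁻¹' V ∈ 𝓝 x := u.continuous.continuousAt hV
  have hsub : ∀ z ∈ u ⁻¹' V, (z ∈ A → u z ∈ B) ∧ (z ∈ frontier A → u z ∉ B) := fun z hz => by
    simpa using hVsub hz
  have hdisj : Disjoint (u ⁻¹' (B ∩ V)) (frontier A) :=
    disjoint_left.2 fun z hz hfr => (hsub z hz.2).2 hfr hz.1
  have hpre : u ⁻¹' (B ∩ V) ⊆ A := by
    refine (subset_or_subset_compl_of_disjoint_frontier (u.isPreconnected_preimage.2 hVconn)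
      hdisj).resolve_right fun hcompl => ?_
    obtain ⟨z, hzV, hz⟩ := mem_closure_iff_nhds.1 hx _ hnear
    exact hcompl ⟨(hsub z hzV).1 hz, hzV⟩ hz
  filter_upwards [hnear] with z hz
  exact ⟨fun hB => hpre ⟨hB, hz⟩, (hsub z hz).1⟩

variable {C A : Set X} {f : X → Y} {y₀ : Y}

theorem finite_inter_preimage_singleton_of_isCompact [T1Space Y] (hC : IsCompact C)
    (hf : ContinuousOn f C) (hinj : ∀ x ∈ C ∩ f ⁻¹' {y₀}, ∃ U ∈ 𝓝[C] x, InjOn f U) :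
    (C ∩ f ⁻¹' {y₀}).Finite := by
  obtain ⟨t, ht, heq⟩ := continuousOn_iff_isClosed.1 hf {y₀} isClosed_singleton
  have hcompact : IsCompact (C ∩ f ⁻¹' {y₀}) := by
    rw [inter_comm, heq]
    exact hC.inter_left ht
  refine hcompact.induction_on finite_empty (fun s t hst ht => ht.subset hst)
    (fun s t => .union) fun x hx => ?_
  obtain ⟨U, hU, hinjU⟩ := hinj x hx
  refine ⟨U ∩ (C ∩ f ⁻¹' {y₀}),
    inter_mem (nhdsWithin_mono x inter_subset_left hU) self_mem_nhdsWithin, ?_⟩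
  exact Subsingleton.finite fun z hz w hw => hinjU hz.1 hw.1 (hz.2.2.trans hw.2.2.symm)

theorem eventually_inter_preimage_singleton_subset [T2Space Y] (hC : IsCompact C)
    (hf : ContinuousOn f C) {W : Set X} (hW : IsOpen W) (hsub : C ∩ f ⁻¹' {y₀} ⊆ W) :
    ∀ᶠ y in 𝓝 y₀, C ∩ f ⁻¹' {y} ⊆ W := by
  have hclosed : IsClosed (f '' (C \ W)) :=
    ((hC.diff hW).image_of_continuousOn (hf.mono sdiff_subset)).isClosed
  have hy₀ : y₀ ∉ f '' (C \ W) := by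
    rintro ⟨z, hz, hzy⟩
    exact hz.2 (hsub ⟨hz.1, hzy⟩)
  filter_upwards [hclosed.isOpen_compl.mem_nhds hy₀] with y hy z hz
  by_contra hzW
  exact hy ⟨z, ⟨hz.1, hzW⟩, hz.2⟩

theorem eventually_ncard_inter_preimage_singleton_eq [T2Space X] [T2Space Y] (hC : IsCompact C)
    (hA : A ⊆ C) (hf : ContinuousOn f C) (u : X → X ≃ₜ Y)
    (hu : ∀ x ∈ C ∩ f ⁻¹' {y₀}, f =ᶠ[𝓝[C] x] u x) :
    ∀ᶠ y in 𝓝 y₀, (A ∩ f ⁻¹' {y}).ncard =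
      {x ∈ C ∩ f ⁻¹' {y₀} | (u x).symm y ∈ A}.ncard := by
  set Q := C ∩ f ⁻¹' {y₀}
  have hQ : Q.Finite := finite_inter_preimage_singleton_of_isCompact hC hf fun x hx =>
    ⟨_, hu x hx, fun z hz w hw hzw => (u x).injective (hz.symm.trans (hzw.trans hw))⟩
  have hsymm : ∀ x ∈ Q, (u x).symm y₀ = x := fun x hx => by
    rw [← show f x = y₀ from hx.2, (hu x hx).self_of_nhdsWithin hx.1, (u x).symm_apply_apply]
  obtain ⟨V, hV, hVdisj⟩ := hQ.t2_separation
  choose! U hUopen hxU hUeq using fun x hx => mem_nhdsWithin.1 (hu x hx)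
  have hcover := eventually_inter_preimage_singleton_subset hC hf
    (isOpen_biUnion fun x (hx : x ∈ Q) => (hV x).2.inter (hUopen x hx))
    fun x hx => mem_biUnion hx ⟨(hV x).1, hxU x hx⟩
  have hnear : ∀ᶠ y in 𝓝 y₀, ∀ x ∈ Q, (u x).symm y ∈ V x ∩ U x :=
    hQ.eventually_all.2 fun x hx => (u x).symm.continuous.continuousAt.eventually_mem <| by
      rw [hsymm x hx]
      exact ((hV x).2.inter (hUopen x hx)).mem_nhds ⟨(hV x).1, hxU x hx⟩
  filter_upwards [hcover, hnear] with y hcover hnear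
  have himage : A ∩ f ⁻¹' {y} = (fun x => (u x).symm y) '' {x ∈ Q | (u x).symm y ∈ A} := by
    refine Subset.antisymm (fun z ⟨hz, hzy⟩ => ?_) ?_
    · obtain ⟨x, hx, -, hzU⟩ := mem_iUnion₂.1 (hcover ⟨hA hz, hzy⟩)
      have hzx : (u x).symm y = z := by
        rw [(u x).symm_apply_eq, ← show f z = y from hzy]
        exact hUeq x hx ⟨hzU, hA hz⟩
      exact ⟨x, ⟨hx, hzx.symm ▸ hz⟩, hzx⟩
    · rintro _ ⟨x, ⟨hx, hxA⟩, rfl⟩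
      exact ⟨hxA, (hUeq x hx ⟨(hnear x hx).2, hA hxA⟩).trans ((u x).apply_symm_apply y)⟩
  rw [himage]
  refine InjOn.ncard_image fun x hx x' hx' (heq : (u x).symm y = (u x').symm y) => ?_
  by_contra hne
  exact disjoint_left.1 (hVdisj hx.1 hx'.1 hne) (hnear x hx.1).1 (heq ▸ (hnear x' hx'.1).1)

end Fibers

/-- A map which slides along the boundary of `Ω`: it moves the boundary points with an outward
normal tangentially and fixes the corners. Regularity up to the boundary is encoded as strict
differentiability within `closure Ω`, with positive Jacobian, off the corners. -/
structure IsSlidingMap (Ω : Set Plane) (Φ : Plane → Plane) : Prop where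
  isOpen : IsOpen Ω
  isBounded : Bornology.IsBounded Ω
  continuousOn : ContinuousOn Φ (closure Ω)
  exists_approximatesLinearOn : ∀ x ∈ closure Ω \ corners Ω, ∃ L : Plane →L[ℝ] Plane,
    0 < L.det ∧ ∀ c : ℝ≥0, 0 < c → ∃ U ∈ 𝓝[closure Ω] x, ApproximatesLinearOn Φ L U c
  inner_sub_eq_zero : ∀ x n, IsOutwardNormal Ω x n → ⟪Φ x - x, n⟫_ℝ = 0
  eq_self : ∀ x ∈ corners Ω, Φ x = x

/-- The parameters, along the line through `x` directed by `b 0`, of the points of the boundary of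
`Ω` with outward normal `b 1`: the edges of `Ω` on that line with `Ω` on a given side. -/
def edgeParams (Ω : Set Plane) (b : OrthonormalBasis (Fin 2) ℝ Plane) (x : Plane) : Set ℝ :=
  {s | IsOutwardNormal Ω (x + s • b 0) (b 1)}

open Classical in
/-- The tangential coordinate of `Φ` along the edges parametrized by `edgeParams Ω b x`, extended
by the identity to the other parameters. -/
noncomputable def edgeMap (Ω : Set Plane) (Φ : Plane → Plane)
    (b : OrthonormalBasis (Fin 2) ℝ Plane) (x : Plane) : ℝ → ℝ :=
  (edgeParams Ω b x).piecewise (fun s => ⟪Φ (x + s • b 0) - x, b 0⟫_ℝ) id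

section Edges

variable {Ω : Set Plane} {b : OrthonormalBasis (Fin 2) ℝ Plane} {x : Plane}

theorem eq_add_inner_smul_of_inner_eq_zero {y : Plane} (h : ⟪y - x, b 1⟫_ℝ = 0) :
    y = x + ⟪y - x, b 0⟫_ℝ • b 0 := by
  have hsum := b.sum_repr (y - x)
  rw [Fin.sum_univ_two, b.repr_apply_apply, b.repr_apply_apply, real_inner_comm, real_inner_comm
    (y - x), h, zero_smul, add_zero] at hsum
  rw [hsum, add_sub_cancel]

theorem isOpen_edgeParams : IsOpen (edgeParams Ω b x) := by
  refine isOpen_iff_mem_nhds.2 fun s hs => ?_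
  have hcont : ContinuousAt (fun t : ℝ => x + t • b 0) s := by fun_prop
  filter_upwards [hcont.eventually (IsOutwardNormal.eventually_of_inner_eq_zero hs)] with t ht
  refine ht ?_
  rw [add_sub_add_left_eq_sub, ← sub_smul, inner_smul_left, b.inner_eq_zero zero_ne_one, mul_zero]

theorem isBounded_edgeParams (hΩ : Bornology.IsBounded Ω) :
    Bornology.IsBounded (edgeParams Ω b x) := by
  have hanti : AntilipschitzWith 1 fun s : ℝ => x + s • b 0 := by
    refine AntilipschitzWith.of_le_mul_dist fun s t => ?_
    simp [dist_eq_norm, ← sub_smul, norm_smul]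
  exact hanti.isBounded_preimage hΩ.closure |>.subset fun s hs => IsOutwardNormal.mem_closure hs

theorem mem_corners_of_mem_frontier_edgeParams {s : ℝ} (hs : s ∈ frontier (edgeParams Ω b x)) :
    x + s • b 0 ∈ corners Ω := by
  have hcont : Continuous fun t : ℝ => x + t • b 0 := by fun_prop
  have hsub : closure (edgeParams Ω b x) ⊆ (fun t : ℝ => x + t • b 0) ⁻¹' frontier Ω :=
    closure_minimal (fun t ht => IsOutwardNormal.mem_frontier ht)
      (isClosed_frontier.preimage hcont)
  refine ⟨hsub hs.1, fun m hm => ?_⟩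
  obtain ⟨t, ht, htm⟩ := ((mem_closure_iff_frequently.1 hs.1).and_eventually
    (hcont.continuousAt.eventually hm.eventually_of_mem_frontier)).exists
  obtain rfl : b 1 = m := IsOutwardNormal.unique ht (htm (IsOutwardNormal.mem_frontier ht))
  rw [isOpen_edgeParams.frontier_eq] at hs
  exact hs.2 hm

theorem edgeMap_of_mem {Φ : Plane → Plane} {s : ℝ} (hs : s ∈ edgeParams Ω b x) :
    edgeMap Ω Φ b x s = ⟪Φ (x + s • b 0) - x, b 0⟫_ℝ := by
  classical exact piecewise_eq_of_mem _ _ _ hs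

theorem eqOn_edgeMap_id {Φ : Plane → Plane} : EqOn (edgeMap Ω Φ b x) id (edgeParams Ω b x)ᶜ := by
  classical exact piecewise_eqOn_compl _ _ _

end Edges

namespace IsSlidingMap

variable {Ω : Set Plane} {Φ : Plane → Plane} {b : OrthonormalBasis (Fin 2) ℝ Plane} {x n : Plane}
  {L : Plane →L[ℝ] Plane}

theorem continuous_edgeMap (hΦ : IsSlidingMap Ω Φ) : Continuous (edgeMap Ω Φ b x) := by
  classical
  have hline : Continuous fun s : ℝ => x + s • b 0 := by fun_prop
  have hsub : closure (edgeParams Ω b x) ⊆ (fun s : ℝ => x + s • b 0) ⁻¹' closure Ω :=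
    closure_minimal (fun t ht => IsOutwardNormal.mem_closure ht)
      (isClosed_closure.preimage hline)
  refine continuous_piecewise (fun s hs => ?_) ?_ continuousOn_id
  · rw [hΦ.eq_self _ (mem_corners_of_mem_frontier_edgeParams hs)]
    simp [inner_smul_left]
  · exact ((hΦ.continuousOn.comp hline.continuousOn hsub).sub continuousOn_const).inner
      continuousOn_const

theorem apply_eq_add_edgeMap_smul (hΦ : IsSlidingMap Ω Φ) {s : ℝ} (hs : s ∈ edgeParams Ω b x) :
    Φ (x + s • b 0) = x + edgeMap Ω Φ b x s • b 0 := by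
  have horth : ⟪Φ (x + s • b 0) - x, b 1⟫_ℝ = 0 := by
    rw [← sub_add_sub_cancel _ (x + s • b 0), inner_add_left, hΦ.inner_sub_eq_zero _ _ hs,
      add_sub_cancel_left, inner_smul_left, b.inner_eq_zero zero_ne_one, mul_zero, add_zero]
  rw [edgeMap_of_mem hs]
  exact eq_add_inner_smul_of_inner_eq_zero horth

theorem hasDerivAt_edgeMap_smul (hΦ : IsSlidingMap Ω Φ) {s : ℝ} (hs : s ∈ edgeParams Ω b x)
    (hL : HasFDerivWithinAt Φ L (closure Ω) (x + s • b 0)) :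
    HasDerivAt (fun t => edgeMap Ω Φ b x t • b 0) (L (b 0)) s := by
  have hnhds : edgeParams Ω b x ∈ 𝓝 s := isOpen_edgeParams.mem_nhds hs
  have hline : HasDerivAt (fun t : ℝ => x + t • b 0) (b 0) s := by
    simpa using ((hasDerivAt_id s).smul_const (b 0)).const_add x
  have hcomp : HasDerivAt (fun t : ℝ => Φ (x + t • b 0) - x) (L (b 0)) s :=
    ((hL.comp_hasDerivWithinAt s hline.hasDerivWithinAt
      fun t ht => IsOutwardNormal.mem_closure ht).hasDerivAt hnhds).sub_const x
  refine hcomp.congr_of_eventuallyEq ?_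
  filter_upwards [hnhds] with t ht
  rw [hΦ.apply_eq_add_edgeMap_smul ht, add_sub_cancel_left]

theorem inner_fderiv_tangent_eq_zero (hΦ : IsSlidingMap Ω Φ) {s : ℝ} (hs : s ∈ edgeParams Ω b x)
    (hL : HasFDerivWithinAt Φ L (closure Ω) (x + s • b 0)) : ⟪L (b 0), b 1⟫_ℝ = 0 := by
  have h := (hΦ.hasDerivAt_edgeMap_smul hs hL).inner ℝ (hasDerivAt_const s (b 1))
  simp only [inner_smul_left, b.inner_eq_zero zero_ne_one, mul_zero, inner_zero_right,
    zero_add] at h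
  exact h.unique (hasDerivAt_const s 0)

theorem hasDerivAt_edgeMap (hΦ : IsSlidingMap Ω Φ) {s : ℝ} (hs : s ∈ edgeParams Ω b x)
    (hL : HasFDerivWithinAt Φ L (closure Ω) (x + s • b 0)) :
    HasDerivAt (edgeMap Ω Φ b x) ⟪L (b 0), b 0⟫_ℝ s := by
  simpa [inner_smul_left] using
    (hΦ.hasDerivAt_edgeMap_smul hs hL).inner ℝ (hasDerivAt_const s (b 0))

theorem exists_hasFDerivWithinAt (hΦ : IsSlidingMap Ω Φ) (hx : IsOutwardNormal Ω x n) :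
    ∃ L : Plane →L[ℝ] Plane, 0 < L.det ∧ HasFDerivWithinAt Φ L (closure Ω) x := by
  obtain ⟨L, hdet, happ⟩ := hΦ.exists_approximatesLinearOn x ⟨hx.mem_closure, fun h => h.2 n hx⟩
  exact ⟨L, hdet, hasFDerivWithinAt_of_approximatesLinearOn hx.mem_closure happ⟩

theorem deriv_edgeMap_ne_zero (hΦ : IsSlidingMap Ω Φ) {s : ℝ} (hs : s ∈ edgeParams Ω b x) :
    deriv (edgeMap Ω Φ b x) s ≠ 0 := by
  obtain ⟨L, hdet, hL⟩ := hΦ.exists_hasFDerivWithinAt hs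
  rw [det_eq_mul_of_inner_eq_zero b (hΦ.inner_fderiv_tangent_eq_zero hs hL)] at hdet
  rw [(hΦ.hasDerivAt_edgeMap hs hL).deriv]
  exact left_ne_zero_of_mul hdet.ne'

theorem bijOn_edgeMap (hΦ : IsSlidingMap Ω Φ) :
    BijOn (edgeMap Ω Φ b x) (edgeParams Ω b x) (edgeParams Ω b x) :=
  bijOn_of_deriv_ne_zero_of_eqOn_id hΦ.continuous_edgeMap (isBounded_edgeParams hΦ.isBounded)
    eqOn_edgeMap_id fun _ => hΦ.deriv_edgeMap_ne_zero

theorem inner_fderiv_normal_pos (hΦ : IsSlidingMap Ω Φ) (hx : IsOutwardNormal Ω x n)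
    (hdet : 0 < L.det) (hL : HasFDerivWithinAt Φ L (closure Ω) x) : 0 < ⟪L n, n⟫_ℝ := by
  obtain ⟨b, rfl⟩ := exists_orthonormalBasis_apply_one_eq hx.1
  have h0 : (0 : ℝ) ∈ edgeParams Ω b x := by simpa [edgeParams] using hx
  have hL0 : HasFDerivWithinAt Φ L (closure Ω) (x + (0 : ℝ) • b 0) := by simpa using hL
  have hmono : StrictMono (edgeMap Ω Φ b x) := strictMono_of_deriv_ne_zero_of_eqOn_id
    hΦ.continuous_edgeMap (isBounded_edgeParams hΦ.isBounded) eqOn_edgeMap_id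
    fun _ => hΦ.deriv_edgeMap_ne_zero
  have htangent : 0 ≤ ⟪L (b 0), b 0⟫_ℝ :=
    (hΦ.hasDerivAt_edgeMap h0 hL0).deriv ▸ hmono.monotone.deriv_nonneg
  rw [det_eq_mul_of_inner_eq_zero b (hΦ.inner_fderiv_tangent_eq_zero h0 hL0)] at hdet
  exact pos_of_mul_pos_right hdet htangent

theorem bijOn_setOf_isOutwardNormal (hΦ : IsSlidingMap Ω Φ) (n : Plane) :
    BijOn Φ {x | IsOutwardNormal Ω x n} {x | IsOutwardNormal Ω x n} := by
  obtain hempty | ⟨x₀, hx₀⟩ := {x | IsOutwardNormal Ω x n}.eq_empty_or_nonempty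
  · rw [hempty]
    exact bijOn_empty _
  obtain ⟨b, rfl⟩ := exists_orthonormalBasis_apply_one_eq hx₀.1
  have h0 {x : Plane} (hx : IsOutwardNormal Ω x (b 1)) : (0 : ℝ) ∈ edgeParams Ω b x := by
    simpa [edgeParams] using hx
  refine ⟨fun x hx => ?_, fun x hx y hy heq => ?_, fun y hy => ?_⟩
  · have h := hΦ.apply_eq_add_edgeMap_smul (h0 hx)
    rw [zero_smul, add_zero] at h
    exact h ▸ hΦ.bijOn_edgeMap.mapsTo (h0 hx)
  · have horth : ⟪y - x, b 1⟫_ℝ = 0 := by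
      have hx0 := hΦ.inner_sub_eq_zero x _ hx
      have hy0 := hΦ.inner_sub_eq_zero y _ hy
      rw [← heq] at hy0
      rw [← sub_sub_sub_cancel_left, inner_sub_left, hx0, hy0, sub_zero]
    obtain ⟨s, rfl⟩ : ∃ s : ℝ, y = x + s • b 0 := ⟨_, eq_add_inner_smul_of_inner_eq_zero horth⟩
    have hs : edgeMap Ω Φ b x s = edgeMap Ω Φ b x 0 := by
      rw [edgeMap_of_mem hy, edgeMap_of_mem (h0 hx), ← heq, zero_smul, add_zero]
    simp [hΦ.bijOn_edgeMap.injOn hy (h0 hx) hs]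
  · obtain ⟨s, hs, hs0⟩ := hΦ.bijOn_edgeMap.surjOn (h0 hy)
    exact ⟨y + s • b 0, hs, by simp [hΦ.apply_eq_add_edgeMap_smul hs, hs0]⟩

theorem isOutwardNormal_apply_iff (hΦ : IsSlidingMap Ω Φ) (hx : x ∈ frontier Ω) :
    IsOutwardNormal Ω (Φ x) n ↔ IsOutwardNormal Ω x n := by
  refine ⟨fun h => ?_, fun h => (hΦ.bijOn_setOf_isOutwardNormal n).mapsTo h⟩
  have hxc : x ∉ corners Ω := fun hc => hc.2 n (hΦ.eq_self x hc ▸ h)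
  obtain ⟨m, hm⟩ := exists_isOutwardNormal_of_mem_frontier_sdiff_corners ⟨hx, hxc⟩
  exact h.unique ((hΦ.bijOn_setOf_isOutwardNormal m).mapsTo hm) ▸ hm

theorem bijOn_frontier (hΦ : IsSlidingMap Ω Φ) : BijOn Φ (frontier Ω) (frontier Ω) := by
  refine ⟨fun x hx => ?_, fun x hx y hy heq => ?_, fun y hy => ?_⟩
  · by_cases hc : x ∈ corners Ω
    · rwa [hΦ.eq_self x hc]
    · obtain ⟨n, hn⟩ := exists_isOutwardNormal_of_mem_frontier_sdiff_corners ⟨hx, hc⟩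
      exact ((hΦ.isOutwardNormal_apply_iff hx).2 hn).mem_frontier
  · have hiff (n : Plane) : IsOutwardNormal Ω x n ↔ IsOutwardNormal Ω y n := by
      rw [← hΦ.isOutwardNormal_apply_iff hx, heq, hΦ.isOutwardNormal_apply_iff hy]
    by_cases hc : x ∈ corners Ω
    · have hc' : y ∈ corners Ω := ⟨hy, fun n hn => hc.2 n ((hiff n).2 hn)⟩
      rw [← hΦ.eq_self x hc, heq, hΦ.eq_self y hc']
    · obtain ⟨n, hn⟩ := exists_isOutwardNormal_of_mem_frontier_sdiff_corners ⟨hx, hc⟩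
      exact (hΦ.bijOn_setOf_isOutwardNormal n).injOn hn ((hiff n).1 hn) heq
  · by_cases hc : y ∈ corners Ω
    · exact ⟨y, hy, hΦ.eq_self y hc⟩
    · obtain ⟨n, hn⟩ := exists_isOutwardNormal_of_mem_frontier_sdiff_corners ⟨hy, hc⟩
      obtain ⟨x, hx, rfl⟩ := (hΦ.bijOn_setOf_isOutwardNormal n).surjOn hn
      exact ⟨x, IsOutwardNormal.mem_frontier hx, rfl⟩

end IsSlidingMap

namespace IsSlidingMap

variable {Ω : Set Plane} {Φ : Plane → Plane} {x n : Plane} {L : Plane →L[ℝ] Plane}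

theorem eventually_inner_sub_neg (hΦ : IsSlidingMap Ω Φ) (hx : IsOutwardNormal Ω x n)
    {U : Set Plane} {c : ℝ≥0} (hU : U ∈ 𝓝[closure Ω] x) (happ : ApproximatesLinearOn Φ L U c)
    (hc : c < ⟪L n, n⟫_ℝ) : ∀ᶠ z in 𝓝 x, z ∈ Ω → ⟪Φ z - Φ x, n⟫_ℝ < 0 := by
  have hproj : Tendsto (fun z : Plane => z - ⟪z - x, n⟫_ℝ • n) (𝓝 x) (𝓝 x) :=
    Continuous.tendsto' (by fun_prop) _ _ (by simp)
  have hmemU := eventually_nhdsWithin_iff.1 hU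
  filter_upwards [hx.eventually_mem_iff, hproj.eventually hx.eventually_of_inner_eq_zero,
    hproj.eventually hmemU, hmemU] with z hzmem hnormal hprojU hzU hz
  set s := ⟪z - x, n⟫_ℝ with hs
  have hs0 : s < 0 := hzmem.1 hz
  have hpx : ⟪z - s • n - x, n⟫_ℝ = 0 := by
    rw [sub_right_comm, inner_sub_left, inner_smul_left, real_inner_self_eq_norm_sq, hx.1]
    simp [hs]
  have hp := hnormal hpx
  -- The foot `z - s • n` and `x` lie on the same edge, along which `Φ` has no normal displacement.
  have hΦpx : ⟪Φ (z - s • n) - Φ x, n⟫_ℝ = 0 := by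
    rw [← sub_add_sub_cancel _ (z - s • n), ← sub_add_sub_cancel (z - s • n) x, inner_add_left,
      inner_add_left, hΦ.inner_sub_eq_zero _ _ hp, hpx, ← neg_sub, inner_neg_left,
      hΦ.inner_sub_eq_zero _ _ hx, neg_zero, add_zero, add_zero]
  have hbound : ⟪Φ z - Φ (z - s • n) - s • L n, n⟫_ℝ ≤ c * -s := by
    have h := happ z (hzU (subset_closure hz)) _ (hprojU hp.mem_closure)
    rw [sub_sub_cancel, map_smul, norm_smul, hx.1, mul_one, Real.norm_of_nonpos hs0.le] at h
    exact (real_inner_le_norm _ n).trans (by rwa [hx.1, mul_one])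
  rw [inner_sub_left, real_inner_smul_left] at hbound
  calc ⟪Φ z - Φ x, n⟫_ℝ = ⟪Φ z - Φ (z - s • n), n⟫_ℝ := by
        rw [← sub_add_sub_cancel _ (Φ (z - s • n)), inner_add_left, hΦpx, add_zero]
    _ ≤ s * (⟪L n, n⟫_ℝ - c) := by linarith
    _ < 0 := mul_neg_of_neg_of_pos hs0 (sub_pos.2 hc)

theorem eventually_apply_mem (hΦ : IsSlidingMap Ω Φ) (hx : IsOutwardNormal Ω x n) :
    ∀ᶠ z in 𝓝 x, z ∈ Ω → Φ z ∈ Ω := by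
  obtain ⟨L, hdet, happ⟩ := hΦ.exists_approximatesLinearOn x ⟨hx.mem_closure, fun h => h.2 n hx⟩
  have hpos : 0 < ⟪L n, n⟫_ℝ := hΦ.inner_fderiv_normal_pos hx hdet
    (hasFDerivWithinAt_of_approximatesLinearOn hx.mem_closure happ)
  obtain ⟨c, hc0, hc⟩ := exists_between hpos
  lift c to ℝ≥0 using hc0.le
  obtain ⟨U, hU, hUc⟩ := happ c hc0
  have hΦx := (hΦ.isOutwardNormal_apply_iff hx.mem_frontier).2 hx
  have hmem := eventually_nhdsWithin_iff.1
    ((hΦ.continuousOn x hx.mem_closure).eventually hΦx.eventually_mem_iff)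
  filter_upwards [hΦ.eventually_inner_sub_neg hx hU hUc hc, hmem] with z hneg hiff hz
  exact (hiff (subset_closure hz)).2 (hneg hz)

theorem exists_homeomorph (hΦ : IsSlidingMap Ω Φ) (hx : x ∈ closure Ω \ corners Ω) :
    ∃ u : Plane ≃ₜ Plane, Φ =ᶠ[𝓝[closure Ω] x] u := by
  obtain ⟨L, hdet, happ⟩ := hΦ.exists_approximatesLinearOn x hx
  exact exists_homeomorph_eventuallyEq_of_approximatesLinearOn hdet.ne' happ

theorem eventually_symm_mem_iff (hΦ : IsSlidingMap Ω Φ) (hx : x ∈ closure Ω \ corners Ω)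
    {u : Plane ≃ₜ Plane} (hu : Φ =ᶠ[𝓝[closure Ω] x] u) :
    ∀ᶠ y in 𝓝 (Φ x), u.symm y ∈ Ω ↔ x ∈ Ω ∨ y ∈ Ω := by
  have hux : Φ x = u x := hu.self_of_nhdsWithin hx.1
  rw [hux, ← u.map_nhds_eq, eventually_map]
  simp only [u.symm_apply_apply]
  by_cases hxΩ : x ∈ Ω
  · filter_upwards [hΦ.isOpen.mem_nhds hxΩ] with z hz
    simp [hz, hxΩ]
  obtain ⟨n, hn⟩ := exists_isOutwardNormal_of_mem_frontier_sdiff_corners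
    ⟨hΦ.isOpen.frontier_eq ▸ ⟨hx.1, hxΩ⟩, hx.2⟩
  have hu' := eventually_nhdsWithin_iff.1 hu
  have hmaps : ∀ᶠ z in 𝓝 x, z ∈ Ω → u z ∈ Ω := by
    filter_upwards [hu', hΦ.eventually_apply_mem hn] with z hzu hz hzΩ
    exact hzu (subset_closure hzΩ) ▸ hz hzΩ
  have hfrontier : ∀ᶠ z in 𝓝 x, z ∈ frontier Ω → u z ∉ Ω := by
    filter_upwards [hu'] with z hzu hz
    rw [← hzu hz.1]
    exact (hΦ.isOpen.frontier_eq ▸ hΦ.bijOn_frontier.mapsTo hz).2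
  have hconn : ∀ W ∈ 𝓝 (u x), ∃ V ∈ 𝓝 (u x), V ⊆ W ∧ IsPreconnected (Ω ∩ V) := by
    intro W hW
    have hΦx := (hΦ.isOutwardNormal_apply_iff hn.mem_frontier).2 hn
    obtain ⟨ε, hε, hball⟩ := Metric.mem_nhds_iff.1 hW
    obtain ⟨r, hconv, hr⟩ := (hΦx.eventually_convex_inter_ball.and (Ioc_mem_nhdsGT hε)).exists
    exact ⟨_, Metric.ball_mem_nhds _ hr.1, (Metric.ball_subset_ball hr.2).trans hball,
      hux ▸ hconv.isPreconnected⟩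
  filter_upwards [eventually_homeomorph_apply_mem_iff u hx.1 hmaps hfrontier hconn] with z hz
  simp [hz, hxΩ]

theorem sdiff_corners_of_apply_notMem_corners (hΦ : IsSlidingMap Ω Φ) (hx : x ∈ closure Ω)
    (h : Φ x ∉ corners Ω) : x ∈ closure Ω \ corners Ω :=
  ⟨hx, fun hc => h ((hΦ.eq_self x hc).symm ▸ hc)⟩

end IsSlidingMap

/-- The number of preimages of `y` in `Ω`, minus the number of preimages (one if `y ∈ Ω`, zero
otherwise) that `Φ` must have in order to be a bijection of `Ω` onto itself. -/
noncomputable def excess (Ω : Set Plane) (Φ : Plane → Plane) (y : Plane) : ℤ :=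
  (Ω ∩ Φ ⁻¹' {y}).ncard - Ω.indicator 1 y

namespace IsSlidingMap

variable {Ω : Set Plane} {Φ : Plane → Plane} {x y : Plane}

theorem isCompact_closure (hΦ : IsSlidingMap Ω Φ) : IsCompact (closure Ω) :=
  hΦ.isBounded.isCompact_closure

theorem exists_homeomorph_of_mem_fiber (hΦ : IsSlidingMap Ω Φ) (hy : y ∉ corners Ω)
    (hx : x ∈ closure Ω ∩ Φ ⁻¹' {y}) :
    ∃ u : Plane ≃ₜ Plane, Φ =ᶠ[𝓝[closure Ω] x] u ∧
      ∀ᶠ z in 𝓝 y, u.symm z ∈ Ω ↔ x ∈ Ω ∨ z ∈ Ω := by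
  obtain ⟨hxΩ, rfl : Φ x = y⟩ := hx
  have hxc := hΦ.sdiff_corners_of_apply_notMem_corners hxΩ hy
  obtain ⟨u, hu⟩ := hΦ.exists_homeomorph hxc
  exact ⟨u, hu, hΦ.eventually_symm_mem_iff hxc hu⟩

theorem finite_fiber (hΦ : IsSlidingMap Ω Φ) (hy : y ∉ corners Ω) :
    (closure Ω ∩ Φ ⁻¹' {y}).Finite := by
  refine finite_inter_preimage_singleton_of_isCompact hΦ.isCompact_closure hΦ.continuousOn
    fun x hx => ?_
  obtain ⟨u, hu, -⟩ := hΦ.exists_homeomorph_of_mem_fiber hy hx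
  exact ⟨_, hu, fun z hz w hw hzw => u.injective (hz.symm.trans (hzw.trans hw))⟩

theorem eventually_ncard_fiber_eq (hΦ : IsSlidingMap Ω Φ) (hy : y ∉ corners Ω) :
    ∀ᶠ z in 𝓝 y, (z ∈ Ω → (Ω ∩ Φ ⁻¹' {z}).ncard = (closure Ω ∩ Φ ⁻¹' {y}).ncard) ∧
      (z ∉ Ω → (Ω ∩ Φ ⁻¹' {z}).ncard = (Ω ∩ Φ ⁻¹' {y}).ncard) := by
  have : Nonempty (Plane ≃ₜ Plane) := ⟨.refl _⟩
  choose! u hu hmem using fun x => hΦ.exists_homeomorph_of_mem_fiber (x := x) hy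
  filter_upwards [eventually_ncard_inter_preimage_singleton_eq hΦ.isCompact_closure subset_closure
    hΦ.continuousOn u hu, (hΦ.finite_fiber hy).eventually_all.2 hmem] with z hz hiff
  rw [hz, sep_ext_iff.2 hiff]
  refine ⟨fun hzΩ => ?_, fun hzΩ => ?_⟩
  · simp only [hzΩ, or_true, sep_true]
  · simp only [hzΩ, or_false]
    rw [sep_mem_eq, inter_right_comm, inter_eq_self_of_subset_right subset_closure]

theorem ncard_closure_fiber_of_mem_frontier (hΦ : IsSlidingMap Ω Φ)
    (hy : y ∈ frontier Ω \ corners Ω) :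
    (closure Ω ∩ Φ ⁻¹' {y}).ncard = (Ω ∩ Φ ⁻¹' {y}).ncard + 1 := by
  obtain ⟨x, hx, rfl⟩ := hΦ.bijOn_frontier.surjOn hy.1
  have hxΩ : x ∉ Ω := (hΦ.isOpen.frontier_eq ▸ hx).2
  have hinsert : closure Ω ∩ Φ ⁻¹' {Φ x} = insert x (Ω ∩ Φ ⁻¹' {Φ x}) := by
    refine Subset.antisymm (fun z hz => ?_)
      (insert_subset ⟨hx.1, rfl⟩ (inter_subset_inter_left _ subset_closure))
    by_cases hzΩ : z ∈ Ω
    · exact .inr ⟨hzΩ, hz.2⟩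
    · exact .inl (hΦ.bijOn_frontier.injOn (hΦ.isOpen.frontier_eq ▸ ⟨hz.1, hzΩ⟩) hx hz.2)
  rw [hinsert, ncard_insert_of_notMem (fun h => hxΩ h.1)
    ((hΦ.finite_fiber hy.2).subset (inter_subset_inter_left _ subset_closure))]

theorem closure_fiber_eq_of_mem (hΦ : IsSlidingMap Ω Φ) (hy : y ∈ Ω) :
    closure Ω ∩ Φ ⁻¹' {y} = Ω ∩ Φ ⁻¹' {y} := by
  refine Subset.antisymm (fun x hx => ⟨?_, hx.2⟩) (inter_subset_inter_left _ subset_closure)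
  by_contra hxΩ
  have hxfr : x ∈ frontier Ω := hΦ.isOpen.frontier_eq ▸ ⟨hx.1, hxΩ⟩
  have hΦx := hΦ.bijOn_frontier.mapsTo hxfr
  rw [hx.2, hΦ.isOpen.frontier_eq] at hΦx
  exact hΦx.2 hy

theorem eventually_excess_eq (hΦ : IsSlidingMap Ω Φ) (hy : y ∉ corners Ω) :
    ∀ᶠ z in 𝓝 y, excess Ω Φ z = excess Ω Φ y := by
  have hncard := hΦ.eventually_ncard_fiber_eq hy
  by_cases hyΩ : y ∈ Ω
  · filter_upwards [hncard, hΦ.isOpen.mem_nhds hyΩ] with z hz hzΩ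
    rw [excess, excess, hz.1 hzΩ, hΦ.closure_fiber_eq_of_mem hyΩ, indicator_of_mem hzΩ,
      indicator_of_mem hyΩ, Pi.one_apply, Pi.one_apply]
  by_cases hyc : y ∈ closure Ω
  · have hclosure :=
      hΦ.ncard_closure_fiber_of_mem_frontier ⟨hΦ.isOpen.frontier_eq ▸ ⟨hyc, hyΩ⟩, hy⟩
    filter_upwards [hncard] with z hz
    by_cases hzΩ : z ∈ Ω
    · simp [excess, hz.1 hzΩ, hzΩ, hyΩ, hclosure]
    · simp [excess, hz.2 hzΩ, hzΩ, hyΩ]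
  · filter_upwards [hncard, isClosed_closure.isOpen_compl.mem_nhds hyc] with z hz hzc
    have hzΩ : z ∉ Ω := fun h => hzc (subset_closure h)
    simp [excess, hz.2 hzΩ, hzΩ, hyΩ]

theorem excess_eq_zero (hΦ : IsSlidingMap Ω Φ) (hcorners : (corners Ω).Countable)
    (hy : y ∉ corners Ω) : excess Ω Φ y = 0 := by
  obtain ⟨z, hz⟩ := (ne_univ_iff_exists_notMem _).1 (hΦ.isCompact_closure.union
    (hΦ.isCompact_closure.image_of_continuousOn hΦ.continuousOn)).ne_univ
  rw [mem_union, not_or] at hz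
  have hzΩ : z ∉ Ω := fun h => hz.1 (subset_closure h)
  have hfiber : Ω ∩ Φ ⁻¹' {z} = ∅ :=
    eq_empty_of_forall_notMem fun x hx => hz.2 ⟨x, subset_closure hx.1, hx.2⟩
  have hconn : IsPreconnected (corners Ω)ᶜ :=
    (hcorners.isPathConnected_compl_of_one_lt_rank Plane.one_lt_rank).isConnected.isPreconnected
  have hcont : ContinuousOn (excess Ω Φ) (corners Ω)ᶜ := fun w hw =>
    (tendsto_nhds_of_eventually_eq (hΦ.eventually_excess_eq hw)).mono_left nhdsWithin_le_nhds
  rw [hconn.constant hcont hy fun h => hz.1 h.1.1]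
  simp [excess, hfiber, hzΩ]

theorem isOpen_image (hΦ : IsSlidingMap Ω Φ) : IsOpen (Φ '' Ω) := by
  refine isOpen_iff_mem_nhds.2 (forall_mem_image.2 fun x hx => ?_)
  have hxfr : x ∉ frontier Ω := fun h => (hΦ.isOpen.frontier_eq ▸ h).2 hx
  obtain ⟨u, hu⟩ := hΦ.exists_homeomorph ⟨subset_closure hx, fun h => hxfr h.1⟩
  rw [nhdsWithin_eq_nhds.2 (mem_of_superset (hΦ.isOpen.mem_nhds hx) subset_closure)] at hu
  rw [hu.self_of_nhds, ← u.map_nhds_eq, ← map_congr hu]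
  exact image_mem_map (hΦ.isOpen.mem_nhds hx)

theorem mapsTo (hΦ : IsSlidingMap Ω Φ) (hcorners : (corners Ω).Countable)
    (hreg : interior (closure Ω) = Ω) : MapsTo Φ Ω Ω := by
  have hclosure : Φ '' Ω ⊆ closure Ω := forall_mem_image.2 fun x hx => by
    by_cases hc : Φ x ∈ corners Ω
    · exact hc.1.1
    by_contra hΦx
    have hzero := hΦ.excess_eq_zero hcorners hc
    have hfin : (Ω ∩ Φ ⁻¹' {Φ x}).Finite :=
      (hΦ.finite_fiber hc).subset (inter_subset_inter_left _ subset_closure)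
    rw [excess, indicator_of_notMem fun h => hΦx (subset_closure h), sub_zero, Nat.cast_eq_zero,
      ncard_eq_zero hfin] at hzero
    exact hzero.subset ⟨hx, rfl⟩
  exact mapsTo_iff_image_subset.2
    ((interior_maximal hclosure hΦ.isOpen_image).trans hreg.subset)

theorem bijOn (hΦ : IsSlidingMap Ω Φ) (hcorners : (corners Ω).Countable)
    (hreg : interior (closure Ω) = Ω) : BijOn Φ Ω Ω := by
  have hunique : ∀ y ∈ Ω, ∃ x, Ω ∩ Φ ⁻¹' {y} = {x} := fun y hy => by
    have hyc : y ∉ corners Ω := fun h => (hΦ.isOpen.frontier_eq ▸ h.1).2 hy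
    have hzero := hΦ.excess_eq_zero hcorners hyc
    rw [excess, indicator_of_mem hy, Pi.one_apply, sub_eq_zero] at hzero
    exact ncard_eq_one.1 (by exact_mod_cast hzero)
  have hmaps := hΦ.mapsTo hcorners hreg
  refine ⟨hmaps, fun x hx z hz heq => ?_, fun y hy => ?_⟩
  · obtain ⟨w, hw⟩ := hunique _ (hmaps hz)
    exact (hw.subset ⟨hx, heq⟩).trans (hw.subset ⟨hz, rfl⟩).symm
  · obtain ⟨x, hx⟩ := hunique y hy
    exact ⟨x, hx.superset rfl⟩

end IsSlidingMap

theorem exists_tendsto_fderiv_det_pos {Ω : Set Plane} {φ Φ : Plane → Plane} {x : Plane}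
    (hΩ : IsOpen Ω) (hφ : φ ∈ C1Closure Ω) (hΦ : ∀ x, Φ x = x + φ x) (hx : x ∈ closure Ω)
    (hJ : 0 < jacobianDet Ω Φ x) :
    ∃ L : Plane →L[ℝ] Plane, 0 < L.det ∧ Tendsto (fderiv ℝ Φ) (𝓝[Ω] x) (𝓝 L) := by
  obtain rfl : Φ = fun x => x + φ x := funext hΦ
  obtain ⟨L, hL⟩ := hφ.2.2 x hx
  have hlim : Tendsto (fderiv ℝ fun x => x + φ x) (𝓝[Ω] x)
      (𝓝 (ContinuousLinearMap.id ℝ Plane + L)) := by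
    refine (tendsto_const_nhds.add hL).congr' ?_
    filter_upwards [self_mem_nhdsWithin] with y hy
    have hd := (hφ.2.1.differentiableOn one_ne_zero y hy).differentiableAt (hΩ.mem_nhds hy)
    exact ((hasFDerivAt_id y).add hd.hasFDerivAt).fderiv.symm
  rw [jacobianDet, extendFrom_eq hx hlim] at hJ
  exact ⟨_, hJ, hlim⟩

theorem eventually_convex_inter_ball_of_mem_closure_sdiff_corners {Ω : Set Plane} {x : Plane}
    (hΩ : IsOpen Ω) (hx : x ∈ closure Ω \ corners Ω) :
    ∀ᶠ r in 𝓝[>] 0, Convex ℝ (Ω ∩ Metric.ball x r) := by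
  by_cases hxΩ : x ∈ Ω
  · obtain ⟨ε, hε, hball⟩ := Metric.isOpen_iff.1 hΩ x hxΩ
    filter_upwards [Ioc_mem_nhdsGT hε] with r hr
    rw [inter_eq_self_of_subset_right ((Metric.ball_subset_ball hr.2).trans hball)]
    exact convex_ball x r
  · obtain ⟨n, hn⟩ := exists_isOutwardNormal_of_mem_frontier_sdiff_corners
      ⟨hΩ.frontier_eq ▸ ⟨hx.1, hxΩ⟩, hx.2⟩
    exact hn.eventually_convex_inter_ball

theorem IsPolygonalRegion.isSlidingMap {Ω : Set Plane} (hΩ : IsPolygonalRegion Ω)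
    {φ Φ : Plane → Plane} (hφ : φ ∈ tangentialC1 Ω) (hΦ : ∀ x, Φ x = x + φ x)
    (hJ : ∀ x ∈ closure Ω \ corners Ω, 0 < jacobianDet Ω Φ x) : IsSlidingMap Ω Φ := by
  obtain ⟨hC1, htan⟩ := hφ
  have hdisp : ∀ x n, IsOutwardNormal Ω x n → ⟪φ x, n⟫_ℝ = 0 := fun x n hn =>
    htan x hn.mem_frontier n hn
  have hcont : ContinuousOn Φ (closure Ω) := (continuousOn_id.add hC1.1).congr fun x _ => hΦ x
  have hdiff : DifferentiableOn ℝ Φ Ω :=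
    (differentiableOn_id.add (hC1.2.1.differentiableOn one_ne_zero)).congr fun x _ => hΦ x
  refine ⟨hΩ.isOpen, hΩ.isBounded, hcont, fun x hx => ?_, fun x n hn => ?_, fun x hx => ?_⟩
  · obtain ⟨L, hdet, hlim⟩ := exists_tendsto_fderiv_det_pos hΩ.isOpen hC1 hΦ hx.1 (hJ x hx)
    exact ⟨L, hdet, fun c hc => exists_mem_nhdsWithin_closure_approximatesLinearOn hΩ.isOpen hdiff
      hcont hlim (eventually_convex_inter_ball_of_mem_closure_sdiff_corners hΩ.isOpen hx) hc⟩
  · rw [hΦ, add_sub_cancel_left]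
    exact hdisp x n hn
  · rw [hΦ, hΩ.eq_zero_of_mem_corners
      ((hC1.1 x hx.1.1).mono frontier_subset_closure) hdisp hx, add_zero]

theorem mainTheorem1_general {Ω : Set Plane} (hΩ : IsPolygonalRegion Ω) {φ Φ : Plane → Plane}
    (hφ : φ ∈ tangentialC1 Ω) (hΦ : ∀ x, Φ x = x + φ x)
    (hJ : ∀ x ∈ closure Ω \ corners Ω, 0 < jacobianDet Ω Φ x) : BijOn Φ Ω Ω :=
  (hΩ.isSlidingMap hφ hΦ hJ).bijOn hΩ.finite_corners.countable hΩ.interior_closure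

theorem mainTheorem1 (Ω : Set Plane) (hΩ : IsRegularPolytope Ω)
    (φ : Plane → Plane) (hφ : φ ∈ tangentialC1 Ω)
    (Φ : Plane → Plane) (hΦ : ∀ x, Φ x = x + φ x)
    (hJ : ∀ x ∈ closure Ω, 0 < jacobianDet Ω Φ x) :
    Set.BijOn Φ Ω Ω :=
  mainTheorem1_general hΩ.isPolygonalRegion hφ hΦ fun x hx => hJ x hx.1
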